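/- Let a linear order be *strongly discrete* if there are only finitely many points strictly between any two of its points. An *interval* is a pair $[x,y]$ with $x<y$. Consider Allen's relations $[x,y]\,R_A\,[x',y'] \Leftrightarrow y=x'$; $[x,y]\,R_B\,[x',y'] \Leftrightarrow x=x',\ y'<y$; $[x,y]\,R_E\,[x',y'] \Leftrightarrow y=y',\ x<x'$, and their inverses $R_{\overline A}, R_{\overline B}, R_{\overline E}$. For a set $X_1,\dots,X_k$ of such relations, the fragment $\mathsf{X_1\cdots X_k}$ of Halpern and Shoham's interval logic consists of the formulas $\varphi ::= p \mid \neg\varphi \mid \varphi\vee\varphi \mid \langle X_1\rangle\varphi\mid\dots\mid\langle X_k\rangle\varphi$ over countably many proposition letters, where $\langle X\rangle\varphi$ holds at an interval $I$ iff $\varphi$ holds at some interval $J$ with $I\,R_X\,J$. A formula is satisfiable (over strongly discrete linear orders) if it holds at some interval of some model based on a strongly discrete linear order, with an arbitrary valuation of the letters by sets of intervals. An *incrementing counter automaton* $\mathcal A=(\Sigma,Q,q_0,C,\Delta,F)$ has a finite alphabet $\Sigma$, a finite set $Q$ of states with initial state $q_0$ and final states $F\subseteq Q$, finitely many counters $C=\{c_1,\dots,c_k\}$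 with values in $\mathbb N$, and a transition relation $\Delta\subseteq Q\times(\Sigma\cup\{\epsilon\})\times(\{inc,dec,ifz\}\times\{1,\dots,k\})\times Q$. An exact step $(q,\bar v)\xrightarrow{l,a}(q',\bar v')$ requires $(q,a,l,q')\in\Delta$ and $v_i'=v_i+1$, $v_i'=v_i-1$, or $v_i'=v_i=0$ for $l=(inc,i),(dec,i),(ifz,i)$ respectively, the other counters being unchanged. An incrementing step $(q,\bar v)\xrightarrow{l,a}_\dagger(q',\bar v')$ is taken if $\bar v\le\bar w$, $(q,\bar w)\xrightarrow{l,a}(q',\bar w')$ and $\bar w'\le\bar v'$ for some $\bar w,\bar w'$, where $\le$ is componentwise. $\mathcal A$ accepts $w\in\Sigma^\omega$ if there is an infinite sequence of incrementing steps from $(q_0,\bar 0)$ whose labels concatenate to $w$ and which visits $F$ infinitely often. The nonemptiness problem asks whether $\mathcal A$ accepts at least one $\omega$-word. **Statement.** For each of the fragments $\mathsf{AE}$, $\mathsf{A\overline E}$, $\mathsf{\overline A B}$ and $\mathsf{\overline A\,\overline B}$: 1. the nonemptiness problem for incrementing counter automata over $\omega$-words reduces to satisfiability for the fragment over strongly discrete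 linear orders, i.e. there is an algorithm that computes from every $\mathcal A$ a formula $\varphi_{\mathcal A}$ of the fragment that is satisfiable over strongly discrete linear orders if and only if $\mathcal A$ accepts some $\omega$-word; 2. satisfiability for the fragment over strongly discrete linear orders is undecidable. -/

import Mathlib

/-! Halpern-Shoham interval logic over strongly discrete linear orders. -/

namespace HS

/-- A linear order is strongly discrete if there are only finitely many points strictly between
any two points. -/
def StronglyDiscrete (D : Type) [LinearOrder D] : Prop :=
  ∀ x y : D, x < y → (Set.Ioo x y).Finite

/-- Intervals under the strict approach: pairs `[lo, hi]` with `lo < hi`. -/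
structure Interval (D : Type) [LinearOrder D] where
  lo : D
  hi : D
  lo_lt_hi : lo < hi

/-- Six of Allen's relations: meets `A`, before `L`, started-by `B`, finished-by `E`,
contains `D`, overlaps `O`. -/
inductive Allen
  | A | L | B | E | D | O
deriving DecidableEq

/-- `X.Rel I J` is the relation `I R_X J`. -/
def Allen.Rel {T : Type} [LinearOrder T] : Allen → Interval T → Interval T → Prop
  | .A, I, J => I.hi = J.lo
  | .L, I, J => I.hi < J.lo
  | .B, I, J => I.lo = J.lo ∧ J.hi < I.hi
  | .E, I, J => I.hi = J.hi ∧ I.lo < J.lo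
  | .D, I, J => I.lo < J.lo ∧ J.hi < I.hi
  | .O, I, J => I.lo < J.lo ∧ J.lo < I.hi ∧ I.hi < J.hi

/-- The twelve modalities: `dir X` is `⟨X⟩` and `inv X` is its inverse `⟨X̄⟩`. -/
inductive Modality
  | dir (X : Allen)
  | inv (X : Allen)
deriving DecidableEq

/-- The accessibility relation of a modality. -/
def Modality.Rel {T : Type} [LinearOrder T] : Modality → Interval T → Interval T → Prop
  | .dir X, I, J => X.Rel I J
  | .inv X, I, J => X.Rel J I

/-- Formulas of the logic; the proposition letters are indexed by `ℕ`. -/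
inductive Formula
  | letter (p : ℕ)
  | neg (φ : Formula)
  | or (φ ψ : Formula)
  | dia (X : Modality) (φ : Formula)

/-- The fragment with the modalities in `S`: formulas all of whose modalities lie in `S`. -/
def Fragment (S : Set Modality) : Set Formula :=
  {φ | go φ}
where
  go : Formula → Prop
    | .letter _ => True
    | .neg φ => go φ
    | .or φ ψ => go φ ∧ go ψ
    | .dia X φ => X ∈ S ∧ go φ

/-- Truth of a formula at an interval under the valuation `V`. -/
def Holds {T : Type} [LinearOrder T] (V : ℕ → Set (Interval T)) : Interval T → Formula → Prop
  | I, .letter p => I ∈ V p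
  | I, .neg φ => ¬ Holds V I φ
  | I, .or φ ψ => Holds V I φ ∨ Holds V I ψ
  | I, .dia X φ => ∃ J : Interval T, X.Rel I J ∧ Holds V J φ

/-- Satisfiability over the class of strongly discrete linear orders. (Every such order is
countable, so orders in `Type` suffice.) -/
def Satisfiable (φ : Formula) : Prop :=
  ∃ (T : Type) (_ : LinearOrder T), StronglyDiscrete T ∧
    ∃ (V : ℕ → Set (Interval T)) (I : Interval T), Holds V I φ

/-! Numbering of formulas, for computability. -/

/-- Position of a modality in a list of the twelve modalities. -/
def Modality.toFin : Modality → Fin 12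
  | .dir .A => 0 | .dir .L => 1 | .dir .B => 2 | .dir .E => 3 | .dir .D => 4 | .dir .O => 5
  | .inv .A => 6 | .inv .L => 7 | .inv .B => 8 | .inv .E => 9 | .inv .D => 10 | .inv .O => 11

/-- Inverse of `Modality.toFin`. -/
def Modality.ofFin : Fin 12 → Modality
  | 0 => .dir .A | 1 => .dir .L | 2 => .dir .B | 3 => .dir .E | 4 => .dir .D | 5 => .dir .O
  | 6 => .inv .A | 7 => .inv .L | 8 => .inv .B | 9 => .inv .E | 10 => .inv .D | 11 => .inv .O

theorem Modality.ofFin_toFin (X : Modality) : Modality.ofFin X.toFin = X := by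
  cases X with
  | dir X => cases X <;> rfl
  | inv X => cases X <;> rfl

theorem Modality.toFin_ofFin (i : Fin 12) : (Modality.ofFin i).toFin = i := by
  fin_cases i <;> rfl

/-- The number of a formula. -/
def Formula.toNat : Formula → ℕ
  | .letter p => 15 * p
  | .neg φ => 15 * φ.toNat + 1
  | .or φ ψ => 15 * Nat.pair φ.toNat ψ.toNat + 2
  | .dia X φ => 15 * φ.toNat + (X.toFin.val + 3)

/-- The formula with a given number. -/
def Formula.ofNat (n : ℕ) : Formula :=
  if h0 : n % 15 = 0 then .letter (n / 15)
  else
    have : n / 15 < n := Nat.div_lt_self (by omega) (by omega)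
    if n % 15 = 1 then .neg (Formula.ofNat (n / 15))
    else if n % 15 = 2 then
      have : (n / 15).unpair.1 < n := lt_of_le_of_lt (Nat.unpair_left_le _) this
      have : (n / 15).unpair.2 < n := lt_of_le_of_lt (Nat.unpair_right_le _) ‹n / 15 < n›
      .or (Formula.ofNat (n / 15).unpair.1) (Formula.ofNat (n / 15).unpair.2)
    else .dia (Modality.ofFin ⟨n % 15 - 3, by omega⟩) (Formula.ofNat (n / 15))
termination_by n

theorem Formula.ofNat_toNat (φ : Formula) : Formula.ofNat φ.toNat = φ := by
  induction φ with
  | letter p =>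
    rw [Formula.ofNat]
    have h : (Formula.letter p).toNat = 15 * p := rfl
    have h1 : (15 * p) % 15 = 0 := by omega
    have h2 : (15 * p) / 15 = p := by omega
    simp [h, h2]
  | neg φ ih =>
    rw [Formula.ofNat]
    have h : (Formula.neg φ).toNat = 15 * φ.toNat + 1 := rfl
    have h1 : (15 * φ.toNat + 1) % 15 = 1 := by omega
    have h2 : (15 * φ.toNat + 1) / 15 = φ.toNat := by omega
    simp [h, h1, h2, ih]
  | or φ ψ ih1 ih2 =>
    rw [Formula.ofNat]
    have h : (Formula.or φ ψ).toNat = 15 * Nat.pair φ.toNat ψ.toNat + 2 := rfl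
    have h1 : (15 * Nat.pair φ.toNat ψ.toNat + 2) % 15 = 2 := by omega
    have h2 : (15 * Nat.pair φ.toNat ψ.toNat + 2) / 15 = Nat.pair φ.toNat ψ.toNat := by omega
    simp [h, h1, h2, ih1, ih2]
  | dia X φ ih =>
    rw [Formula.ofNat]
    have h : (Formula.dia X φ).toNat = 15 * φ.toNat + (X.toFin.val + 3) := rfl
    have hX := X.toFin.isLt
    have h1 : (15 * φ.toNat + (X.toFin.val + 3)) % 15 = X.toFin.val + 3 := by omega
    have h2 : (15 * φ.toNat + (X.toFin.val + 3)) / 15 = φ.toNat := by omega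
    simp [h, h1, h2, ih, Modality.ofFin_toFin]

theorem Formula.toNat_ofNat (n : ℕ) : (Formula.ofNat n).toNat = n := by
  induction n using Nat.strong_induction_on with
  | _ n ih =>
    rw [Formula.ofNat]
    split_ifs with h0 h1 h2
    · simp only [Formula.toNat]; omega
    · have := ih (n / 15) (by omega)
      simp only [Formula.toNat, this]; omega
    · have hl := Nat.unpair_left_le (n / 15)
      have hr := Nat.unpair_right_le (n / 15)
      have e1 := ih (n / 15).unpair.1 (by omega)
      have e2 := ih (n / 15).unpair.2 (by omega)
      simp only [Formula.toNat, e1, e2, Nat.pair_unpair]; omega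
    · have := ih (n / 15) (by omega)
      simp only [Formula.toNat, this, Modality.toFin_ofFin]; omega

/-- Formulas are numbered effectively; computability of functions on formulas refers to this
numbering. -/
instance : Denumerable Formula :=
  Denumerable.mk' ⟨Formula.toNat, Formula.ofNat, Formula.ofNat_toNat, Formula.toNat_ofNat⟩

/-- Decidability of the satisfiability problem for the fragment with the modalities in `S`:
some algorithm answers correctly on all formulas of the fragment. -/
def SatDecidable (S : Set Modality) : Prop :=
  ∃ d : Formula → Bool, Computable d ∧ ∀ φ ∈ Fragment S, (d φ = true ↔ Satisfiable φ)

end HS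

/-! Incrementing counter automata over infinite words. -/

namespace ICA

/-- The three kinds of instructions. -/
inductive Op
  | inc | dec | ifz
deriving DecidableEq

/-- The three instruction kinds, numbered. -/
def Op.equivFin : Op ≃ Fin 3 where
  toFun
    | .inc => 0
    | .dec => 1
    | .ifz => 2
  invFun
    | 0 => .inc
    | 1 => .dec
    | 2 => .ifz
  left_inv o := by cases o <;> rfl
  right_inv i := by fin_cases i <;> rfl

instance : Primcodable Op := Primcodable.ofEquiv (Fin 3) Op.equivFin

/-- A counter automaton with alphabet `α`, states `Q` and counters `C`. In a transition
`(q, a, l, q')`, the label `a = none` stands for the empty word. -/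
structure Automaton (α Q C : Type) where
  init : Q
  trans : Set (Q × Option α × (Op × C) × Q)
  final : Set Q

variable {α Q C : Type}

/-- Effect of an instruction on the counter values; the other counters keep their values. -/
def Exec (l : Op × C) (v v' : C → ℕ) : Prop :=
  (∀ j, j ≠ l.2 → v' j = v j) ∧
    match l.1 with
    | .inc => v' l.2 = v l.2 + 1
    | .dec => v l.2 = v' l.2 + 1
    | .ifz => v l.2 = 0 ∧ v' l.2 = 0

/-- The exact (error-free) transition from `(q, v)` to `(q', v')` with instruction `l` and
label `a`. -/
def Automaton.Step (M : Automaton α Q C) (l : Op × C) (a : Option α) (c c' : Q × (C → ℕ)) : Prop :=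
  (c.1, a, l, c'.1) ∈ M.trans ∧ Exec l c.2 c'.2

/-- The incrementing transition: counters may grow before and after an exact transition. -/
def Automaton.IncStep (M : Automaton α Q C) (l : Op × C) (a : Option α)
    (c c' : Q × (C → ℕ)) : Prop :=
  ∃ w w' : C → ℕ, c.2 ≤ w ∧ M.Step l a (c.1, w) (c'.1, w') ∧ w' ≤ c'.2

/-- The infinite concatenation of the labels `a 0, a 1, …` is the infinite word `w`: the
positions of the labels other than the empty word form an infinite increasing sequence, along
which the letters of `w` are read. -/
def Spells (a : ℕ → Option α) (w : ℕ → α) : Prop :=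
  ∃ g : ℕ → ℕ, StrictMono g ∧ Set.range g = {n | a n ≠ none} ∧ ∀ n, a (g n) = some (w n)

/-- `M` accepts `w`: an infinite run over `w` from the initial state with all counters `0`
visits final states infinitely often. -/
def Automaton.Accepts (M : Automaton α Q C) (w : ℕ → α) : Prop :=
  ∃ (c : ℕ → Q × (C → ℕ)) (a : ℕ → Option α),
    c 0 = (M.init, 0) ∧
    (∀ n, ∃ l, M.IncStep l (a n) (c n) (c (n + 1))) ∧
    Spells a w ∧
    ∃ᶠ n in Filter.atTop, (c n).1 ∈ M.final

/-- Finite descriptions `(μ, ν, k, Δ, F)` of automata: states `0, …, μ` with initial state `0`,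
letters `0, …, ν - 1`, counters `0, …, k - 1`, the list `Δ` of transitions and the list `F` of
final states. -/
abbrev Descr : Type :=
  ℕ × ℕ × ℕ × List (ℕ × Option ℕ × (Op × ℕ) × ℕ) × List ℕ

/-- The automaton given by a description (list entries that are out of range are ignored). -/
def Descr.toAutomaton (d : Descr) : Automaton (Fin d.2.1) (Fin (d.1 + 1)) (Fin d.2.2.1) where
  init := 0
  trans := {t | (t.1.val, t.2.1.map Fin.val, (t.2.2.1.1, t.2.2.1.2.val), t.2.2.2.val) ∈ d.2.2.2.1}
  final := {q | q.val ∈ d.2.2.2.2}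

/-- Every automaton with states `0, …, μ`, initial state `0`, letters `0, …, ν - 1` and counters
`0, …, k - 1` has a description. -/
theorem exists_descr (μ ν k : ℕ) (M : Automaton (Fin ν) (Fin (μ + 1)) (Fin k))
    (h0 : M.init = 0) : ∃ Δ F, Descr.toAutomaton (μ, ν, k, Δ, F) = M := by
  classical
  have : Finite (Op × Fin k) := by
    have : Finite Op := Finite.of_equiv _ Op.equivFin.symm
    infer_instance
  obtain ⟨i, t, f⟩ := M
  obtain rfl : i = 0 := h0
  refine ⟨t.toFinite.toFinset.toList.map
      (fun t => (t.1.val, t.2.1.map Fin.val, (t.2.2.1.1, t.2.2.1.2.val), t.2.2.2.val)),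
    f.toFinite.toFinset.toList.map Fin.val, ?_⟩
  have hinj : Function.Injective
      (fun t : Fin (μ + 1) × Option (Fin ν) × (Op × Fin k) × Fin (μ + 1) =>
        (t.1.val, t.2.1.map Fin.val, (t.2.2.1.1, t.2.2.1.2.val), t.2.2.2.val)) := by
    rintro ⟨q, a, ⟨o, j⟩, q'⟩ ⟨r, b, ⟨p, l⟩, r'⟩ h
    simp only [Prod.mk.injEq] at h
    obtain ⟨h1, h2, ⟨h3, h4⟩, h5⟩ := h
    rw [Fin.ext h1, Option.map_injective Fin.val_injective h2, h3, Fin.ext h4, Fin.ext h5]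
  unfold Descr.toAutomaton
  congr 1
  · ext x
    rw [Set.mem_ofPred_eq]
    refine (List.mem_map_of_injective hinj).trans ?_
    simp
  · ext x
    rw [Set.mem_ofPred_eq]
    refine (List.mem_map_of_injective Fin.val_injective).trans ?_
    simp

/-- The nonemptiness problem: the described automaton accepts at least one infinite word. -/
def Descr.AcceptsSome (d : Descr) : Prop :=
  ∃ w : ℕ → Fin d.2.1, d.toAutomaton.Accepts w

end ICA

/-- A reduction from the nonemptiness problem for incrementing counter automata to the
satisfiability problem for the fragment with the modalities in `S`: a computable map that sends
every automaton to a formula of the fragment that is satisfiable over the strongly discrete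
linear orders if and only if the automaton accepts some infinite word. -/
def NonemptinessReducesTo (S : Set HS.Modality) : Prop :=
  ∃ f : ICA.Descr → HS.Formula, Computable f ∧
    ∀ d : ICA.Descr, f d ∈ HS.Fragment S ∧ (HS.Satisfiable (f d) ↔ d.AcceptsSome)

/-! An incrementing automaton may as well err as little as possible: the only error worth making is
to raise an empty counter to one just before decrementing it. So acceptance amounts to an infinite
run in which decrements are truncated at zero (`Descr.acceptsSome_iff`). In such a run a counter is
zero at a given step as soon as all increments so far are matched injectively with later decrements
so far (`val_eq_zero_of_matching`). Conversely, if it is zero, popping a stack of pending increments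
yields such a matching (`exists_matched`).

The logic can describe this. Transition letters are made to depend only on the left end point, so
that they label points. Intervals marked `u` link successive positions of the run, and intervals
marked `m` for a counter link increments to decrements. The modality `A` suffices to speak about all
intervals starting no earlier than some point and to demand successors, matching partners, and the
recurrence of final states and of letters read. `E` or its inverse compares intervals with a common
right end. It forbids labelled points strictly inside `u` intervals, two matching intervals with the
same right end, and matching intervals that jump over a zero test. In a strongly discrete order an
infinite increasing sequence is unbounded, so the chain of `u` intervals catches every labelled
point and the labels along it form a run (`exists_lazyRun_of_holds`). Conversely a run gives a model
on `ℕ` (`satisfiable_of_lazyRun`). Reversing the order turns `A`, `E` into inverse `A`, `B`, which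
yields the other two fragments.

For undecidability it remains to see that nonemptiness is undecidable; non-halting is reduced to it.
A program, run by an exact counter machine, is simulated over and over by an automaton whose work is
paid from a conserved stock of units. Between two final visits the stock grows by one unit, and a
series of simulations is made with budgets descending to zero; each simulation has to use up its
budget. Without errors this works when the machine runs forever (`Machine.exists_lazyRun_descr`).
The only error, a truncated decrement, creates a unit. If the machine has no long computations,
then, once the stock is large, a simulation with a large budget can be completed only with an error,
so the budget regains the unit it was to lose. It never reaches zero and no final state is visited
again (`Machine.not_lazyRun_descr`). -/

namespace ICA

/-! ### Runs with truncated decrements instead of incrementing errors -/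

/-- A transition of a description: source, label, instruction, target. -/
abbrev Trans : Type := ℕ × Option ℕ × (Op × ℕ) × ℕ

/-- The transition respects the bounds of the description. -/
def Descr.InRange (d : Descr) (t : Trans) : Prop :=
  t.1 ≤ d.1 ∧ (∀ a ∈ t.2.1, a < d.2.1) ∧ t.2.2.1.2 < d.2.2.1 ∧ t.2.2.2 ≤ d.1

/-- The value of a counter after a truncated execution of an instruction. -/
def Op.apply : Op → ℕ → ℕ
  | .inc, n => n + 1
  | .dec, n => n - 1
  | .ifz, n => n

/-- Value of counter `i` before step `n` when decrements are truncated. -/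
def val (τ : ℕ → Trans) (i : ℕ) : ℕ → ℕ
  | 0 => 0
  | n + 1 => if (τ n).2.2.1.2 = i then (τ n).2.2.1.1.apply (val τ i n) else val τ i n

/-- Accepting runs of a description with truncated decrements. -/
structure Descr.LazyRun (d : Descr) (τ : ℕ → Trans) : Prop where
  mem : ∀ n, τ n ∈ d.2.2.2.1
  inRange : ∀ n, d.InRange (τ n)
  start : (τ 0).1 = 0
  link : ∀ n, (τ (n + 1)).1 = (τ n).2.2.2
  zero : ∀ n, (τ n).2.2.1.1 = .ifz → val τ (τ n).2.2.1.2 n = 0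
  final : ∀ N, ∃ n, N < n ∧ (τ n).1 ∈ d.2.2.2.2
  label : ∀ N, ∃ n, N < n ∧ (τ n).2.1 ≠ none

theorem frequently_iff_forall_exists_lt {p : ℕ → Prop} :
    (∃ᶠ n in Filter.atTop, p n) ↔ ∀ N, ∃ n, N < n ∧ p n := by
  rw [Filter.frequently_atTop']

theorem exists_spells_iff {α : Type} (a : ℕ → Option α) :
    (∃ w, Spells a w) ↔ ∀ N, ∃ n, N < n ∧ a n ≠ none := by
  classical
  constructor
  · rintro ⟨w, g, hg, hr, -⟩ N
    refine ⟨g (N + 1), lt_of_lt_of_le (Nat.lt_succ_self N) hg.le_apply, ?_⟩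
    have : g (N + 1) ∈ Set.range g := ⟨_, rfl⟩
    rw [hr] at this
    exact this
  · intro h
    have hinf : ({n | a n ≠ none} : Set ℕ).Infinite := by
      rw [← Nat.frequently_atTop_iff_infinite]
      exact frequently_iff_forall_exists_lt.2 h
    have hs : ∀ n, a (Nat.nth (fun n => a n ≠ none) n) ≠ none := Nat.nth_mem_of_infinite hinf
    choose w hw using fun n => Option.ne_none_iff_exists'.1 (hs n)
    exact ⟨w, _, Nat.nth_strictMono hinf, Nat.range_nth_of_infinite hinf, hw⟩

/-- Truncated execution is monotone, so by induction its counter values stay below those of any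
incrementing run with the same transitions. Zero tests passed by the latter are therefore passed by
the former. -/
theorem Descr.AcceptsSome.exists_lazyRun {d : Descr} (h : d.AcceptsSome) :
    ∃ τ, d.LazyRun τ := by
  obtain ⟨w, c, a, h0, hstep, hsp, hfin⟩ := h
  choose l hl using hstep
  have hlab := (exists_spells_iff a).1 ⟨w, hsp⟩
  rw [frequently_iff_forall_exists_lt] at hfin
  set τ : ℕ → Trans := fun n =>
    ((c n).1.val, (a n).map Fin.val, ((l n).1, (l n).2.val), (c (n + 1)).1.val) with hτ
  have hval : ∀ n (i : Fin d.2.2.1), val τ i n ≤ (c n).2 i := by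
    intro n i
    induction n with
    | zero => simp [val]
    | succ n ih =>
      obtain ⟨v, v', hv, ⟨-, hne, hex⟩, hv'⟩ := hl n
      have h1 := hv i
      have h2 := hv' i
      by_cases hi : (l n).2 = i
      · subst hi
        have e : val τ (l n).2 (n + 1) = (l n).1.apply (val τ (l n).2 n) := if_pos rfl
        rw [e]
        revert hex
        cases (l n).1 <;> simp only [Op.apply] <;> intro hex <;> simp only at h1 h2 ih <;> omega
      · have := hne i (Ne.symm hi)
        have hi' : (l n).2.val ≠ i.val := fun h => hi (Fin.ext h)
        have e : val τ i (n + 1) = val τ i n := if_neg hi'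
        simp only at h1 h2 ih this
        omega
  refine ⟨τ, ?_, ?_, ?_, fun n => rfl, ?_, ?_, ?_⟩
  · intro n
    obtain ⟨v, v', -, ⟨hm, -⟩, -⟩ := hl n
    exact hm
  · intro n
    refine ⟨Nat.lt_succ_iff.1 (c n).1.isLt, ?_, (l n).2.isLt, Nat.lt_succ_iff.1 (c (n + 1)).1.isLt⟩
    intro b hb
    obtain ⟨b', -, rfl⟩ := Option.mem_map.1 hb
    exact b'.isLt
  · simp only [hτ, h0]; rfl
  · intro n hn
    obtain ⟨v, v', hv, ⟨-, hne, hex⟩, hv'⟩ := hl n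
    have hn' : (l n).1 = .ifz := hn
    rw [hn'] at hex
    have h1 := hv (l n).2
    have h2 := hval n (l n).2
    simp only at hex h1
    show val τ (l n).2.val n = 0
    omega
  · intro N
    obtain ⟨n, hn, hf⟩ := hfin N
    exact ⟨n, hn, hf⟩
  · intro N
    obtain ⟨n, hn, hf⟩ := hlab N
    refine ⟨n, hn, ?_⟩
    simpa [hτ] using hf

/-- A truncated decrement of an empty counter is an incrementing step: the counter is first raised
to one. All other steps are exact. -/
theorem Descr.LazyRun.acceptsSome {d : Descr} {τ : ℕ → Trans} (h : d.LazyRun τ) :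
    d.AcceptsSome := by
  have hr := h.inRange
  let q : ℕ → Fin (d.1 + 1) := fun n => ⟨(τ n).1, Nat.lt_succ_iff.2 (hr n).1⟩
  let k : ℕ → Fin d.2.2.1 := fun n => ⟨(τ n).2.2.1.2, (hr n).2.2.1⟩
  let a : ℕ → Option (Fin d.2.1) := fun n => (τ n).2.1.pmap Fin.mk (hr n).2.1
  have ha : ∀ n, (a n).map Fin.val = (τ n).2.1 := by
    intro n
    simp only [a]
    rw [Option.map_pmap, Option.pmap_eq_map, Option.map_id']
  obtain ⟨w, hw⟩ := (exists_spells_iff a).2 (fun N => by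
    obtain ⟨n, hn, h1⟩ := h.label N
    refine ⟨n, hn, fun h2 => h1 ?_⟩
    rw [← ha, h2]; rfl)
  refine ⟨w, fun n => (q n, fun i => val τ i n), a, ?_, ?_, hw, ?_⟩
  · refine Prod.ext (Fin.ext h.start) ?_
    funext i; rfl
  · intro n
    refine ⟨((τ n).2.2.1.1, k n), ?_⟩
    have hmem : (q n, a n, ((τ n).2.2.1.1, k n), q (n + 1)) ∈ (Descr.toAutomaton d).trans := by
      show (_, _, _, _) ∈ d.2.2.2.1
      simp only [ha, q, k, h.link]
      exact h.mem n
    have hz := h.zero n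
    have hk : ∀ i : Fin d.2.2.1, (τ n).2.2.1.2 = i.val ↔ i = k n := fun i =>
      ⟨fun h => Fin.ext h.symm, fun h => by rw [h]⟩
    have hkk : (k n).val = (τ n).2.2.1.2 := rfl
    rcases hop : (τ n).2.2.1.1 with _ | _ | _
    · refine ⟨fun i => val τ i n, fun i => val τ i (n + 1), le_rfl, ⟨hop ▸ hmem, ?_, ?_⟩, le_rfl⟩
      · intro j hj
        have := mt (hk j).1 hj
        simp [val, this]
      · simp [val, hop, Op.apply, hkk]
    -- The intermediate value is one more than the value after the step: the old value if that was
    -- positive, and `1`, by an error, if it was `0`.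
    · refine ⟨fun i => val τ i (n + 1) + if i = k n then 1 else 0, fun i => val τ i (n + 1), ?_,
        ⟨hop ▸ hmem, ?_, ?_⟩, le_rfl⟩
      · intro i
        by_cases hi : i = k n
        · have := (hk i).2 hi
          simp only [val, hop, Op.apply, hi, hkk, if_true]
          omega
        · have := mt (hk i).1 hi
          simp [val, this]
      · intro j hj
        have hj' : j ≠ k n := hj
        simp [hj']
      · simp
    · refine ⟨fun i => val τ i n, fun i => val τ i (n + 1), le_rfl, ⟨hop ▸ hmem, ?_, ?_⟩, le_rfl⟩
      · intro j hj
        have := mt (hk j).1 hj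
        simp [val, this]
      · simp [val, hop, Op.apply, hkk, hz hop]
  · rw [frequently_iff_forall_exists_lt]
    intro N
    obtain ⟨n, hn, hf⟩ := h.final N
    exact ⟨n, hn, hf⟩

theorem Descr.acceptsSome_iff (d : Descr) : d.AcceptsSome ↔ ∃ τ, d.LazyRun τ :=
  ⟨fun h => h.exists_lazyRun, fun ⟨_, h⟩ => h.acceptsSome⟩

end ICA

/-! ### Empty counters and matchings of increments with decrements -/

namespace ICA

theorem val_succ_of_ne {τ : ℕ → Trans} {i n : ℕ} (h : (τ n).2.2.1.2 ≠ i) :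
    val τ i (n + 1) = val τ i n := if_neg h

theorem val_succ_of_eq {τ : ℕ → Trans} {i n : ℕ} {o : Op} (h : (τ n).2.2.1 = (o, i)) :
    val τ i (n + 1) = o.apply (val τ i n) := by
  rw [val, h]; exact if_pos rfl

/-- A counter is empty if all increments have been matched injectively with later decrements. -/
theorem val_eq_zero_of_matching {τ : ℕ → Trans} {i N : ℕ} (R : ℕ → ℕ → Prop)
    (hlt : ∀ j m, R j m → j < m)
    (hinj : ∀ j j' m, R j m → R j' m → j = j')
    (hdec : ∀ j m, R j m → (τ m).2.2.1 = (Op.dec, i))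
    (htot : ∀ j < N, (τ j).2.2.1 = (Op.inc, i) → ∃ m < N, R j m) : val τ i N = 0 := by
  classical
  -- The increments before `n` that have no partner before `n`. The counter never exceeds their
  -- number.
  let P : ℕ → Finset ℕ := fun n =>
    (Finset.range n).filter fun j => (τ j).2.2.1 = (Op.inc, i) ∧ ¬ ∃ m < n, R j m
  have key : ∀ n, val τ i n ≤ (P n).card := by
    intro n
    induction n with
    | zero => simp [val]
    | succ n ih =>
      by_cases hi : (τ n).2.2.1.2 = i
      · obtain ⟨o, ho⟩ : ∃ o, (τ n).2.2.1 = (o, i) := ⟨_, Prod.ext rfl hi⟩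
        rw [val_succ_of_eq ho]
        have hsub : o ≠ .dec → P n ⊆ P (n + 1) := by
          intro hod j hj
          simp only [P, Finset.mem_filter, Finset.mem_range] at hj ⊢
          refine ⟨by omega, hj.2.1, ?_⟩
          rintro ⟨m, hm, hR⟩
          rcases Nat.lt_succ_iff_lt_or_eq.1 hm with hm | rfl
          · exact hj.2.2 ⟨m, hm, hR⟩
          · have := hdec _ _ hR
            rw [ho] at this
            exact hod (congrArg Prod.fst this)
        cases o with
        | inc =>
          have hn : n ∉ P n := by simp [P]
          have h1 : insert n (P n) ⊆ P (n + 1) := by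
            refine Finset.insert_subset ?_ (hsub (by simp))
            simp only [P, Finset.mem_filter, Finset.mem_range]
            refine ⟨by omega, ho, ?_⟩
            rintro ⟨m, hm, hR⟩
            have := hlt _ _ hR
            omega
          have := Finset.card_le_card h1
          rw [Finset.card_insert_of_notMem hn] at this
          simp only [Op.apply]
          omega
        | dec =>
          -- By injectivity a decrement settles at most one pending increment, while it lowers the
          -- counter by one unless the counter is already `0`. If it settles none, `j` is arbitrary.
          have h1 : ∃ j, P n ⊆ insert j (P (n + 1)) := by
            by_cases hj : ∃ j, R j n
            · obtain ⟨j, hj⟩ := hj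
              refine ⟨j, fun l hl => ?_⟩
              simp only [P, Finset.mem_insert, Finset.mem_filter, Finset.mem_range] at hl ⊢
              by_cases hlj : l = j
              · exact Or.inl hlj
              refine Or.inr ⟨by omega, hl.2.1, ?_⟩
              rintro ⟨m, hm, hR⟩
              rcases Nat.lt_succ_iff_lt_or_eq.1 hm with hm | rfl
              · exact hl.2.2 ⟨m, hm, hR⟩
              · exact hlj (hinj _ _ _ hR hj)
            · refine ⟨0, fun l hl => ?_⟩
              simp only [P, Finset.mem_insert, Finset.mem_filter, Finset.mem_range] at hl ⊢
              refine Or.inr ⟨by omega, hl.2.1, ?_⟩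
              rintro ⟨m, hm, hR⟩
              rcases Nat.lt_succ_iff_lt_or_eq.1 hm with hm | rfl
              · exact hl.2.2 ⟨m, hm, hR⟩
              · exact hj ⟨_, hR⟩
          obtain ⟨j, h1⟩ := h1
          have := (Finset.card_le_card h1).trans (Finset.card_insert_le _ _)
          simp only [Op.apply]
          omega
        | ifz => exact ih.trans (Finset.card_le_card (hsub (by simp)))
      · rw [val_succ_of_ne hi]
        refine ih.trans (Finset.card_le_card fun j hj => ?_)
        simp only [P, Finset.mem_filter, Finset.mem_range] at hj ⊢
        refine ⟨by omega, hj.2.1, ?_⟩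
        rintro ⟨m, hm, hR⟩
        rcases Nat.lt_succ_iff_lt_or_eq.1 hm with hm | rfl
        · exact hj.2.2 ⟨m, hm, hR⟩
        · have := hdec _ _ hR
          exact hi (congrArg Prod.snd this)
  have hP : P N = ∅ := by
    refine Finset.filter_eq_empty_iff.2 fun j hj h => h.2 ?_
    exact htot j (Finset.mem_range.1 hj) h.1
  have := key N
  rw [hP] at this
  simpa using this

/-- The stack of increments of counter `i` that are unmatched before step `n`. -/
def stack (τ : ℕ → Trans) (i : ℕ) : ℕ → List ℕ
  | 0 => []
  | n + 1 =>
    if (τ n).2.2.1 = (Op.inc, i) then n :: stack τ i n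
    else if (τ n).2.2.1 = (Op.dec, i) then (stack τ i n).tail
    else stack τ i n

/-- The decrement at step `m` is matched with the increment at step `j`. -/
def Matched (τ : ℕ → Trans) (i j m : ℕ) : Prop :=
  (τ m).2.2.1 = (Op.dec, i) ∧ (stack τ i m).head? = some j

/-- `tail` of the empty list is empty, which is exactly the truncation of decrements. -/
theorem length_stack (τ : ℕ → Trans) (i n : ℕ) : (stack τ i n).length = val τ i n := by
  induction n with
  | zero => rfl
  | succ n ih =>
    by_cases hi : (τ n).2.2.1.2 = i
    · obtain ⟨o, ho⟩ : ∃ o, (τ n).2.2.1 = (o, i) := ⟨_, Prod.ext rfl hi⟩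
      rw [val_succ_of_eq ho, stack, ho]
      cases o <;> simp [Op.apply, ih]
    · have h : ∀ o, (τ n).2.2.1 ≠ (o, i) := fun o ho => hi (congrArg Prod.snd ho)
      rw [val_succ_of_ne hi, stack, if_neg (h _), if_neg (h _), ih]

theorem mem_stack_succ {τ : ℕ → Trans} {i n j : ℕ} (h : j ∈ stack τ i (n + 1)) :
    j = n ∨ j ∈ stack τ i n := by
  rw [stack] at h
  split_ifs at h
  · simpa using h
  · exact Or.inr (List.mem_of_mem_tail h)
  · exact Or.inr h

/-- Once the stack has been empty, whatever it contains was pushed afterwards. Hence no matched pair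
straddles a zero test. -/
theorem le_of_mem_stack {τ : ℕ → Trans} {i N n j : ℕ} (hN : stack τ i N = []) (hn : N ≤ n)
    (h : j ∈ stack τ i n) : N ≤ j := by
  induction n, hn using Nat.le_induction with
  | base => simp [hN] at h
  | succ n hn ih =>
    rcases mem_stack_succ h with rfl | h
    · exact hn
    · exact ih h

/-- An entry leaves the stack only by being popped from the top, and it must have left by the time
the stack is empty. -/
theorem exists_matched {τ : ℕ → Trans} {i N n j : ℕ} (hN : stack τ i N = []) (hn : n ≤ N)
    (h : j ∈ stack τ i n) : ∃ m, n ≤ m ∧ m < N ∧ Matched τ i j m := by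
  by_contra! hne
  have : ∀ m, n ≤ m → m ≤ N → j ∈ stack τ i m := by
    intro m hm
    induction m, hm using Nat.le_induction with
    | base => exact fun _ => h
    | succ m hm ih =>
      intro hmN
      have hj := ih (by omega)
      rw [stack]
      split_ifs with h1 h2
      · exact List.mem_cons_of_mem _ hj
      · obtain ⟨x, l, hxl⟩ := List.exists_cons_of_ne_nil (List.ne_nil_of_mem hj)
        rw [hxl] at hj ⊢
        rcases List.mem_cons.1 hj with rfl | hj
        · exact absurd ⟨h2, by rw [hxl]; rfl⟩ (hne m hm (by omega))
        · exact hj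
      · exact hj
  have := this N hn le_rfl
  simp [hN] at this

end ICA

/-! ### Formulas that describe runs -/

namespace HS

open ICA

namespace Formula

/-- Truth. -/
def top : Formula := or (letter 0) (neg (letter 0))
/-- Falsity. -/
def bot : Formula := neg top
/-- Conjunction. -/
def and (φ ψ : Formula) : Formula := neg (or (neg φ) (neg ψ))
/-- Implication. -/
def imp (φ ψ : Formula) : Formula := or (neg φ) ψ
/-- The dual of a modality. -/
def box (X : Modality) (φ : Formula) : Formula := neg (dia X (neg φ))
/-- Conjunction of a list. -/
def bigAnd (l : List Formula) : Formula := l.foldr and top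
/-- Disjunction of a list. -/
def bigOr (l : List Formula) : Formula := l.foldr or bot

end Formula

open Formula

section semantics

variable {T : Type} [LinearOrder T] (V : ℕ → Set (Interval T)) (I : Interval T)

theorem holds_and (φ ψ : Formula) : Holds V I (φ.and ψ) ↔ Holds V I φ ∧ Holds V I ψ := by
  simp [Formula.and, Holds, not_or]

theorem holds_imp (φ ψ : Formula) : Holds V I (φ.imp ψ) ↔ (Holds V I φ → Holds V I ψ) := by
  simp [Formula.imp, Holds, imp_iff_not_or]

theorem holds_box (X : Modality) (φ : Formula) :
    Holds V I (φ.box X) ↔ ∀ J, X.Rel I J → Holds V J φ := by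
  simp [Formula.box, Holds]

theorem holds_top : Holds V I top := by
  simp only [top, Holds]; exact em _

theorem holds_bigAnd (l : List Formula) : Holds V I (bigAnd l) ↔ ∀ φ ∈ l, Holds V I φ := by
  induction l with
  | nil => simpa [bigAnd] using holds_top V I
  | cons φ l ih =>
    rw [List.forall_mem_cons, ← ih, ← holds_and]; rfl

theorem holds_bigOr (l : List Formula) : Holds V I (bigOr l) ↔ ∃ φ ∈ l, Holds V I φ := by
  induction l with
  | nil =>
    have : bigOr [] = neg top := rfl
    simp [this, Holds, holds_top]
  | cons φ l ih =>
    rw [List.exists_mem_cons_iff, ← ih]; rfl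

/-- Some interval starting at `y` satisfies `φ`. -/
def HoldsAt (y : T) (φ : Formula) : Prop := ∃ z, ∃ h : y < z, Holds V ⟨y, z, h⟩ φ

theorem holds_dia_A (φ : Formula) : Holds V I (dia (.dir .A) φ) ↔ HoldsAt V I.hi φ := by
  constructor
  · rintro ⟨⟨y, z, h⟩, (rfl : I.hi = y), hφ⟩
    exact ⟨z, h, hφ⟩
  · rintro ⟨z, h, hφ⟩
    exact ⟨⟨I.hi, z, h⟩, rfl, hφ⟩

theorem holds_box_A (φ : Formula) :
    Holds V I (box (.dir .A) φ) ↔ ∀ z, ∀ h : I.hi < z, Holds V ⟨I.hi, z, h⟩ φ := by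
  rw [holds_box]
  constructor
  · intro H z h
    exact H _ rfl
  · rintro H ⟨y, z, h⟩ (rfl : I.hi = y)
    exact H z h

end semantics

/-- `φ` holds at all intervals that are reached in at most two steps of `a`. -/
def globally (a : Modality) (φ : Formula) : Formula :=
  φ.and ((box a φ).and (box a (box a φ)))

/-- With `e = ⟨E⟩` and `b = true`, or `e = ⟨Ē⟩` and `b = false`, the statement that there are no
intervals `[x, y]` with `φ` and `[z, y]` with `ψ` such that `x < z < y`. -/
def forb (e : Modality) (b : Bool) (φ ψ : Formula) : Formula :=
  bif b then imp φ (box e (neg ψ)) else imp ψ (box e (neg φ))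

/-- The letter for a transition, a property of the left end point. -/
def tLetter (t : Trans) : Formula := letter (3 * Encodable.encode t)
/-- The letter for the matching of increments with decrements of a counter. -/
def mLetter (i : ℕ) : Formula := letter (3 * i + 1)
/-- The letter for intervals between successive positions of the run. -/
def uLetter : Formula := letter 2

/-- One of the transitions in a list. -/
def anyOf (L : List Trans) : Formula := bigOr (L.map tLetter)

/-- One of the transitions with a given instruction. -/
def anyInstr (L : List Trans) (l : Op × ℕ) : Formula := anyOf (L.filter fun t => t.2.2.1 = l)

/-- The conditions on the positions of a transition. -/
def conditions (a e : Modality) (b : Bool) (L : List Trans) (F : List ℕ) (t : Trans) : Formula :=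
  bigAnd
    [imp (dia a (tLetter t)) (box a (tLetter t)),
     imp (tLetter t) (neg (anyOf (L.filter fun t' => t' ≠ t))),
     imp (dia a (tLetter t))
      (dia a (and uLetter (dia a (anyOf (L.filter fun t' => t'.1 = t.2.2.2))))),
     -- Steps of the chain may not skip a position, so that labelled points cannot hide off the
     -- chain.
     forb e b uLetter (tLetter t),
     -- Only intervals with a common right end can be compared, so injectivity is enforced but
     -- uniqueness of the partner is not; counting needs only the former.
     forb e b (mLetter t.2.2.1.2) (mLetter t.2.2.1.2),
     -- A partner is required only when some zero test is still to come; the condition after this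
     -- one makes it come before the next such test.
     imp (and (dia a (anyInstr L (.inc, t.2.2.1.2))) (dia a (dia a (anyInstr L (.ifz, t.2.2.1.2)))))
      (dia a (and (mLetter t.2.2.1.2) (dia a (anyInstr L (.dec, t.2.2.1.2))))),
     forb e b (mLetter t.2.2.1.2) (anyInstr L (.ifz, t.2.2.1.2)),
     imp (dia a (tLetter t)) (dia a (dia a (anyOf (L.filter fun t' => t'.1 ∈ F)))),
     imp (dia a (tLetter t)) (dia a (dia a (anyOf (L.filter fun t' => t'.2.1 ≠ none))))]

instance (d : Descr) : DecidablePred d.InRange := fun t => by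
  unfold Descr.InRange; infer_instance

/-- The transitions of a description that respect its bounds. -/
def validTrans (d : Descr) : List Trans := d.2.2.2.1.filter d.InRange

/-- The formula that describes the accepting runs of an automaton. -/
def runFormula (a e : Modality) (b : Bool) (d : Descr) : Formula :=
  and (dia a (anyOf ((validTrans d).filter fun t => t.1 = 0)))
    (globally a (bigAnd ((validTrans d).map (conditions a e b (validTrans d) d.2.2.2.2))))

theorem mem_validTrans {d : Descr} {t : Trans} :
    t ∈ validTrans d ↔ t ∈ d.2.2.2.1 ∧ d.InRange t := by
  simp [validTrans]

theorem holds_anyOf {T : Type} [LinearOrder T] (V : ℕ → Set (Interval T)) (I : Interval T)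
    (L : List Trans) : Holds V I (anyOf L) ↔ ∃ t ∈ L, Holds V I (tLetter t) := by
  simp [anyOf, holds_bigOr]

/-- `e` and `b` fit together such that `forb e b` has its intended meaning. -/
def ForbParam (e : Modality) (b : Bool) : Prop :=
  (e = .dir .E ∧ b = true) ∨ (e = .inv .E ∧ b = false)

theorem ForbParam.holds_forb {e : Modality} {b : Bool} (h : ForbParam e b)
    {T : Type} [LinearOrder T] {V : ℕ → Set (Interval T)} {φ ψ : Formula}
    (H : ∀ x z y : T, ∀ (hxz : x < z) (hzy : z < y), Holds V ⟨x, y, hxz.trans hzy⟩ φ →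
      ¬ Holds V ⟨z, y, hzy⟩ ψ) (I : Interval T) : Holds V I (forb e b φ ψ) := by
  rcases h with ⟨rfl, rfl⟩ | ⟨rfl, rfl⟩
  · simp only [forb, cond_true, holds_imp, holds_box]
    rintro hφ ⟨z, y, hzy⟩ ⟨(h1 : I.hi = y), h2⟩
    subst h1
    exact H _ _ _ h2 hzy hφ
  · simp only [forb, cond_false, holds_imp, holds_box]
    rintro hψ ⟨z, y, hzy⟩ ⟨(h1 : y = I.hi), h2⟩ hφ
    subst h1
    exact H _ _ _ h2 I.lo_lt_hi hφ hψ

/-- Depending on the modality, the ban is stated at the longer or at the shorter of the two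
intervals. Assuming it at both covers the two cases uniformly. -/
theorem ForbParam.not_and {e : Modality} {b : Bool} (h : ForbParam e b)
    {T : Type} [LinearOrder T] {V : ℕ → Set (Interval T)} {φ ψ : Formula} {x z y : T}
    (hxz : x < z) (hzy : z < y)
    (h1 : Holds V ⟨x, y, hxz.trans hzy⟩ (forb e b φ ψ)) (h2 : Holds V ⟨z, y, hzy⟩ (forb e b φ ψ))
    (hφ : Holds V ⟨x, y, hxz.trans hzy⟩ φ) (hψ : Holds V ⟨z, y, hzy⟩ ψ) : False := by
  rcases h with ⟨rfl, rfl⟩ | ⟨rfl, rfl⟩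
  · simp only [forb, cond_true, holds_imp, holds_box] at h1
    exact h1 hφ ⟨z, y, hzy⟩ ⟨rfl, hxz⟩ hψ
  · simp only [forb, cond_false, holds_imp, holds_box] at h2
    exact h2 hψ ⟨x, y, hxz.trans hzy⟩ ⟨rfl, hxz⟩ hφ

end HS

/-! ### From models to runs -/

namespace HS

open ICA Formula

/-- A bounded increasing sequence would put infinitely many points between its first term and the
bound. This is the only use of strong discreteness in extracting a run. -/
theorem StronglyDiscrete.exists_lt {T : Type} [LinearOrder T] (hT : StronglyDiscrete T)
    {x : ℕ → T} (hx : StrictMono x) (z : T) : ∃ n, z < x n := by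
  by_contra! hle
  have hlt : ∀ n, x n < z := fun n => (hx (Nat.lt_succ_self n)).trans_le (hle _)
  refine Set.infinite_of_injective_forall_mem (f := fun n => x (n + 1)) ?_ ?_ (hT (x 0) z (hlt 0))
  · intro m n h
    simpa using hx.injective h
  · exact fun n => ⟨hx n.succ_pos, hlt _⟩

theorem holds_neg {T : Type} [LinearOrder T] (V : ℕ → Set (Interval T)) (I : Interval T)
    (φ : Formula) : Holds V I (neg φ) ↔ ¬ Holds V I φ := Iff.rfl

section HoldsAt

variable {T : Type} [LinearOrder T] (V : ℕ → Set (Interval T)) (y : T)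

theorem holdsAt_anyOf (L : List Trans) :
    HoldsAt V y (anyOf L) ↔ ∃ t ∈ L, HoldsAt V y (tLetter t) := by
  simp only [HoldsAt, holds_anyOf]
  constructor
  · rintro ⟨z, h, t, ht, h'⟩; exact ⟨t, ht, z, h, h'⟩
  · rintro ⟨t, ht, z, h, h'⟩; exact ⟨z, h, t, ht, h'⟩

theorem holdsAt_dia (φ : Formula) :
    HoldsAt V y (dia (.dir .A) φ) ↔ ∃ z, y < z ∧ HoldsAt V z φ := by
  constructor
  · rintro ⟨z, h, h'⟩; exact ⟨z, h, (holds_dia_A V _ φ).1 h'⟩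
  · rintro ⟨z, h, h'⟩; exact ⟨z, h, (holds_dia_A V _ φ).2 h'⟩

theorem holdsAt_and (φ ψ : Formula) : HoldsAt V y (φ.and ψ) ↔
    ∃ z, ∃ h : y < z, Holds V ⟨y, z, h⟩ φ ∧ Holds V ⟨y, z, h⟩ ψ := by
  simp only [HoldsAt, holds_and]

end HoldsAt

/-- The run is read off a chain of `u` intervals that begins at the right end of `I`. The intervals
marked `m` between points of the chain provide the matchings that justify its zero tests. -/
theorem exists_lazyRun_of_holds {e : Modality} {b : Bool} (hp : ForbParam e b) {d : Descr}
    {T : Type} [LinearOrder T] (hT : StronglyDiscrete T) {V : ℕ → Set (Interval T)}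
    {I : Interval T} (H : Holds V I (runFormula (.dir .A) e b d)) : ∃ τ, d.LazyRun τ := by
  obtain ⟨h0, H⟩ := (holds_and V I _ _).1 H
  simp only [globally, holds_and, holds_box] at H
  obtain ⟨H1, H2, H3⟩ := H
  set L := validTrans d with hL
  -- One application of `A` reaches the intervals starting at `I.hi`, two applications those
  -- starting at later points.
  have G' : ∀ J : Interval T, I.hi ≤ J.lo → ∀ t ∈ L,
      Holds V J (conditions (.dir .A) e b L d.2.2.2.2 t) := by
    intro J hJ t ht
    have hm := List.mem_map_of_mem (f := conditions (.dir .A) e b L d.2.2.2.2) ht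
    rcases hJ.eq_or_lt with hJ | hJ
    · exact (holds_bigAnd V J _).1 (H2 J hJ) _ hm
    · exact (holds_bigAnd V J _).1 (H3 ⟨I.hi, J.lo, hJ⟩ rfl J rfl) _ hm
  -- Conditions about a point `y` are stated through `A` at an interval ending in `y`; for the first
  -- point this interval is `I` itself.
  have G : ∀ y, I.hi ≤ y → ∃ J : Interval T, J.hi = y ∧ ∀ t ∈ L,
      Holds V J (conditions (.dir .A) e b L d.2.2.2.2 t) := by
    intro y hy
    rcases hy.eq_or_lt with hy | hy
    · exact ⟨I, hy, fun t ht => (holds_bigAnd V I _).1 H1 _ (List.mem_map_of_mem ht)⟩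
    · exact ⟨⟨I.hi, y, hy⟩, rfl, G' ⟨I.hi, y, hy⟩ le_rfl⟩
  simp only [conditions, holds_bigAnd, List.forall_mem_cons, holds_imp, holds_and, anyInstr,
    holds_anyOf, holds_dia_A, holds_box_A, holds_neg, holdsAt_anyOf, holdsAt_dia, holdsAt_and,
    List.mem_filter, decide_eq_true_eq] at G G' h0
  have unif : ∀ y, I.hi ≤ y → ∀ t ∈ L, HoldsAt V y (tLetter t) →
      ∀ z, ∀ h : y < z, Holds V ⟨y, z, h⟩ (tLetter t) := by
    intro y hy t ht
    obtain ⟨J, rfl, hJ⟩ := G y hy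
    exact (hJ t ht).1
  have uniq : ∀ y, I.hi ≤ y → ∀ t ∈ L, ∀ t' ∈ L, HoldsAt V y (tLetter t) →
      HoldsAt V y (tLetter t') → t' = t := by
    rintro y hy t ht t' ht' ⟨z, hz, h⟩ h'
    by_contra hne
    refine (G' ⟨y, z, hz⟩ hy t ht).2.1 h ⟨t', ?_, unif y hy t' ht' h' z hz⟩
    exact ⟨ht', hne⟩
  have next : ∀ p : {p : T × Trans // I.hi ≤ p.1 ∧ p.2 ∈ L ∧ HoldsAt V p.1 (tLetter p.2)},
      ∃ p' : {p : T × Trans // I.hi ≤ p.1 ∧ p.2 ∈ L ∧ HoldsAt V p.1 (tLetter p.2)},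
        p'.1.2.1 = p.1.2.2.2.2 ∧ ∃ h : p.1.1 < p'.1.1, Holds V ⟨p.1.1, p'.1.1, h⟩ uLetter := by
    rintro ⟨⟨y, t⟩, hy, ht, hyt⟩
    obtain ⟨J, rfl, hJ⟩ := G y hy
    obtain ⟨z, hz, hu, t', ⟨ht', hs⟩, hzt⟩ := (hJ t ht).2.2.1 hyt
    exact ⟨⟨(z, t'), hy.trans hz.le, ht', hzt⟩, hs, hz, hu⟩
  obtain ⟨t0, ⟨ht0, hs0⟩, hI0⟩ := h0
  choose nx hnx1 hnx2 hnx3 using next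
  let p : ℕ → {p : T × Trans // I.hi ≤ p.1 ∧ p.2 ∈ L ∧ HoldsAt V p.1 (tLetter p.2)} :=
    fun n => nx^[n] ⟨(I.hi, t0), le_rfl, ht0, hI0⟩
  have hps : ∀ n, p (n + 1) = nx (p n) := fun n => Function.iterate_succ_apply' _ _ _
  let x : ℕ → T := fun n => (p n).1.1
  let τ : ℕ → Trans := fun n => (p n).1.2
  have hx : StrictMono x := by
    refine strictMono_nat_of_lt_succ fun n => ?_
    have := hnx2 (p n)
    rw [← hps] at this
    exact this
  have hxI : ∀ n, I.hi ≤ x n := fun n => (p n).2.1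
  have hτL : ∀ n, τ n ∈ L := fun n => (p n).2.2.1
  have hxτ : ∀ n, HoldsAt V (x n) (tLetter (τ n)) := fun n => (p n).2.2.2
  have hu : ∀ n, Holds V ⟨x n, x (n + 1), hx n.lt_succ_self⟩ uLetter := by
    intro n
    have := hnx3 (p n)
    simp only [← hps] at this
    exact this
  have forb_of : ∀ φ ψ, (∀ J : Interval T, I.hi ≤ J.lo → Holds V J (forb e b φ ψ)) →
      ∀ x z y, I.hi ≤ x → ∀ (hxz : x < z) (hzy : z < y), Holds V ⟨x, y, hxz.trans hzy⟩ φ →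
      ¬ Holds V ⟨z, y, hzy⟩ ψ := by
    intro φ ψ h x z y hx hxz hzy hφ hψ
    exact hp.not_and hxz hzy (h _ hx) (h _ (hx.trans hxz.le)) hφ hψ
  -- The chain is unbounded, so `z` lies in some half-open section from `x n` to `x (n + 1)`. It
  -- cannot be strictly inside, because a `u` interval contains no labelled point.
  have onChain : ∀ z, I.hi ≤ z → ∀ t ∈ L, HoldsAt V z (tLetter t) → ∃ n, z = x n ∧ t = τ n := by
    intro z hz t ht hzt
    have hex := hT.exists_lt hx z
    obtain ⟨n, hn1, hn2⟩ : ∃ n, x n ≤ z ∧ z < x (n + 1) := by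
      classical
      obtain ⟨n, hn⟩ : ∃ n, Nat.find hex = n + 1 := by
        refine Nat.exists_eq_succ_of_ne_zero fun h => ?_
        have := Nat.find_spec hex
        rw [h] at this
        exact not_lt_of_ge hz this
      exact ⟨n, not_lt.1 (Nat.find_min hex (m := n) (by omega)), hn ▸ Nat.find_spec hex⟩
    rcases hn1.eq_or_lt with rfl | hn1
    · exact ⟨n, rfl, uniq _ (hxI n) _ (hτL n) _ ht (hxτ n) hzt⟩
    · exact (forb_of _ _ (fun J hJ => (G' J hJ t ht).2.2.2.1) _ _ _ (hxI n) hn1 hn2 (hu n)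
        (unif z hz t ht hzt _ hn2)).elim
  refine ⟨τ, fun n => (mem_validTrans.1 (hτL n)).1, fun n => (mem_validTrans.1 (hτL n)).2, hs0, ?_,
    ?_, ?_, ?_⟩
  · intro n
    have := hnx1 (p n)
    rw [← hps] at this
    exact this
  · intro N hN
    set i := (τ N).2.2.1.2 with hi
    have minj := forb_of _ _ (fun J hJ => (G' J hJ _ (hτL N)).2.2.2.2.1)
    have mzero := forb_of _ _ (fun J hJ => (G' J hJ _ (hτL N)).2.2.2.2.2.2.1)
    have hNi : (τ N).2.2.1 = (Op.ifz, i) := Prod.ext hN rfl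
    refine val_eq_zero_of_matching (fun j m => (τ m).2.2.1 = (Op.dec, i) ∧
      ∃ h : x j < x m, Holds V ⟨x j, x m, h⟩ (mLetter i)) ?_ ?_ (fun j m h => h.1) ?_
    · rintro j m ⟨-, h, -⟩
      exact hx.lt_iff_lt.1 h
    · rintro j j' m ⟨-, h1, h2⟩ ⟨-, h1', h2'⟩
      rcases lt_trichotomy j j' with h | h | h
      · exact (minj _ _ _ (hxI j) (hx h) h1' h2 h2').elim
      · exact h
      · exact (minj _ _ _ (hxI j') (hx h) h1 h2' h2).elim
    · intro j hj hji
      obtain ⟨J, hJ, hc⟩ := G (x j) (hxI j)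
      have hc := (hc _ (hτL N)).2.2.2.2.2.1
      rw [hJ] at hc
      obtain ⟨y, hy, hm, t, ⟨ht, hti⟩, hyt⟩ := hc
        ⟨⟨τ j, ⟨hτL j, hji⟩, hxτ j⟩, x N, hx hj, τ N, ⟨hτL N, hNi⟩, hxτ N⟩
      obtain ⟨m, rfl, rfl⟩ := onChain y ((hxI j).trans hy.le) t ht hyt
      refine ⟨m, ?_, hti, hy, hm⟩
      -- Equality would make step `N` a decrement and a zero test at once; a later `m` would give a
      -- matching interval that jumps over the zero test at `N`.
      rcases lt_trichotomy m N with h | h | h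
      · exact h
      · subst h
        rw [hNi] at hti
        simp at hti
      · refine (mzero _ _ _ (hxI j) (hx hj) (hx h) hm ?_).elim
        rw [holds_anyOf]
        exact ⟨τ N, by simp [hτL N, hNi], unif _ (hxI N) _ (hτL N) (hxτ N) _ _⟩
  · intro N
    obtain ⟨J, hJ, hc⟩ := G (x N) (hxI N)
    have hc := (hc _ (hτL N)).2.2.2.2.2.2.2.1
    rw [hJ] at hc
    obtain ⟨y, hy, t, ⟨ht, htF⟩, hyt⟩ := hc (hxτ N)
    obtain ⟨m, rfl, rfl⟩ := onChain y ((hxI N).trans hy.le) t ht hyt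
    exact ⟨m, hx.lt_iff_lt.1 hy, htF⟩
  · intro N
    obtain ⟨J, hJ, hc⟩ := G (x N) (hxI N)
    have hc := (hc _ (hτL N)).2.2.2.2.2.2.2.2.1
    rw [hJ] at hc
    obtain ⟨y, hy, t, ⟨ht, htF⟩, hyt⟩ := hc (hxτ N)
    obtain ⟨m, rfl, rfl⟩ := onChain y ((hxI N).trans hy.le) t ht hyt
    exact ⟨m, hx.lt_iff_lt.1 hy, htF⟩

/-! ### From runs to models on the natural numbers -/

/-- The valuation on the natural numbers given by a run whose steps are at the points `1, 2, …`. -/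
def runValuation (τ : ℕ → Trans) (p : ℕ) : Set (Interval ℕ) :=
  {I | 1 ≤ I.lo ∧ ((p % 3 = 0 ∧ Encodable.encode (τ (I.lo - 1)) = p / 3) ∨
    (p % 3 = 1 ∧ Matched τ (p / 3) (I.lo - 1) (I.hi - 1)) ∨ (p % 3 = 2 ∧ I.hi = I.lo + 1))}

/-- Step `n` sits at the point `n + 1`, which leaves `[0, 1]` as an interval ending at the first
position. The clause `1 ≤ I.lo` of the valuation excludes the point `0`, where the truncated `I.lo -
1` would wrongly give step `0`. -/
theorem holds_tLetter (τ : ℕ → Trans) (J : Interval ℕ) (t : Trans) :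
    Holds (runValuation τ) J (tLetter t) ↔ ∃ n, J.lo = n + 1 ∧ τ n = t := by
  simp only [tLetter, Holds, runValuation, Set.mem_ofPred_eq, Nat.mul_mod_right,
    Nat.mul_div_cancel_left _ (show 0 < 3 by norm_num), Encodable.encode_inj]
  constructor
  · rintro ⟨h, h'⟩
    refine ⟨J.lo - 1, by omega, ?_⟩
    simpa using h'
  · rintro ⟨n, h1, rfl⟩
    simp [h1]

theorem holds_mLetter (τ : ℕ → Trans) (J : Interval ℕ) (i : ℕ) :
    Holds (runValuation τ) J (mLetter i) ↔ ∃ j m, J.lo = j + 1 ∧ J.hi = m + 1 ∧ Matched τ i j m := by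
  have h1 : (3 * i + 1) % 3 = 1 := by omega
  have h2 : (3 * i + 1) / 3 = i := by omega
  simp only [mLetter, Holds, runValuation, Set.mem_ofPred_eq, h1, h2]
  constructor
  · rintro ⟨h, h'⟩
    have := J.lo_lt_hi
    refine ⟨J.lo - 1, J.hi - 1, by omega, by omega, ?_⟩
    simpa using h'
  · rintro ⟨j, m, h1, h2, h⟩
    simp [h1, h2, h]

theorem holds_uLetter (τ : ℕ → Trans) (J : Interval ℕ) :
    Holds (runValuation τ) J uLetter ↔ 1 ≤ J.lo ∧ J.hi = J.lo + 1 := by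
  simp [uLetter, Holds, runValuation]

theorem satisfiable_of_lazyRun {e : Modality} {b : Bool} (hp : ForbParam e b) {d : Descr}
    {τ : ℕ → Trans} (h : d.LazyRun τ) : Satisfiable (runFormula (.dir .A) e b d) := by
  refine ⟨ℕ, inferInstance, fun x y _ => Set.finite_Ioo x y, runValuation τ, ⟨0, 1, one_pos⟩, ?_⟩
  have hmem : ∀ n, τ n ∈ validTrans d := fun n => mem_validTrans.2 ⟨h.mem n, h.inRange n⟩
  have at_t : ∀ y t, HoldsAt (runValuation τ) y (tLetter t) ↔ ∃ n, y = n + 1 ∧ τ n = t := by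
    intro y t
    simp only [HoldsAt, holds_tLetter]
    exact ⟨fun ⟨_, _, h⟩ => h, fun h => ⟨y + 1, by omega, h⟩⟩
  have at_any : ∀ y (P : Trans → Prop) [DecidablePred P],
      HoldsAt (runValuation τ) y (anyOf ((validTrans d).filter fun t => P t)) ↔
        ∃ n, y = n + 1 ∧ P (τ n) := by
    intro y P _
    simp only [HoldsAt, holds_anyOf, holds_tLetter, List.mem_filter, decide_eq_true_eq]
    constructor
    · rintro ⟨z, _, t, ⟨_, hP⟩, n, hn, rfl⟩
      exact ⟨n, hn, hP⟩
    · rintro ⟨n, hn, hP⟩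
      exact ⟨y + 1, by omega, τ n, ⟨hmem n, hP⟩, n, hn, rfl⟩
  rw [runFormula, holds_and, holds_dia_A, at_any]
  refine ⟨⟨0, rfl, h.start⟩, ?_⟩
  suffices H : ∀ J, Holds (runValuation τ) J (bigAnd ((validTrans d).map
      (conditions (.dir .A) e b (validTrans d) d.2.2.2.2))) by
    simp only [globally, holds_and, holds_box]
    exact ⟨H _, fun J _ => H J, fun _ _ J _ => H J⟩
  intro J
  rw [holds_bigAnd]
  intro φ hφ
  obtain ⟨t, ht, rfl⟩ := List.mem_map.1 hφ
  simp only [conditions, holds_bigAnd, List.forall_mem_cons, anyInstr]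
  refine ⟨?_, ?_, ?_, hp.holds_forb ?_ J, hp.holds_forb ?_ J, ?_, hp.holds_forb ?_ J, ?_, ?_, ?_⟩
  · rw [holds_imp, holds_dia_A, holds_box_A, at_t]
    intro hn z hz
    rw [holds_tLetter]
    exact hn
  · rw [holds_imp, Holds, holds_anyOf]
    rintro ht ⟨t', ht', h'⟩
    rw [holds_tLetter] at ht h'
    obtain ⟨n, hn, rfl⟩ := ht
    obtain ⟨m, hm, rfl⟩ := h'
    obtain rfl : n = m := by omega
    simp at ht'
  · rw [holds_imp, holds_dia_A, holds_dia_A, at_t, holdsAt_and]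
    rintro ⟨n, hn, rfl⟩
    refine ⟨J.hi + 1, by omega, ?_, ?_⟩
    · rw [holds_uLetter]
      exact ⟨by simp [hn], rfl⟩
    · rw [holds_dia_A, at_any]
      exact ⟨n + 1, by simp [hn], h.link n⟩
  · intro x z y hxz hzy hu ht
    rw [holds_uLetter] at hu
    simp only at hu
    omega
  · intro x z y hxz hzy h1 h2
    -- A decrement pops a single stack entry, so matching intervals with the same right end also
    -- have the same left end.
    rw [holds_mLetter] at h1 h2
    obtain ⟨j, m, hj, hm, -, h1⟩ := h1
    obtain ⟨j', m', hj', hm', -, h2⟩ := h2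
    simp only at hj hm hj' hm'
    obtain rfl : m = m' := by omega
    rw [h1] at h2
    have := Option.some.inj h2
    omega
  · rw [holds_imp, holds_and, holds_dia_A, holds_dia_A, holds_dia_A, at_any, holdsAt_dia, holdsAt_and]
    rintro ⟨⟨j, hj, hji⟩, z, hz, hz'⟩
    obtain ⟨N, rfl, hN⟩ := (at_any _ _).1 hz'
    have hv := h.zero N (congrArg Prod.fst hN)
    rw [hN, ← length_stack, List.length_eq_zero_iff] at hv
    have hmj : j ∈ stack τ t.2.2.1.2 (j + 1) := by
      rw [stack, if_pos hji]
      exact List.mem_cons_self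
    obtain ⟨m, hm, -, hmm⟩ := exists_matched hv (by omega) hmj
    refine ⟨m + 1, by omega, ?_, ?_⟩
    · rw [holds_mLetter]
      exact ⟨j, m, hj, rfl, hmm⟩
    · rw [holds_dia_A, at_any]
      exact ⟨m, rfl, hmm.1⟩
  · intro x z y hxz hzy hm hz
    rw [holds_mLetter] at hm
    obtain ⟨j, m, hj, hm, hmm⟩ := hm
    obtain ⟨N, hN, hNz⟩ := (at_any z _).1 ⟨y, hzy, hz⟩
    simp only at hj hm
    -- The stack is empty at the test `N`, so an increment popped after `N` was pushed no earlier
    -- than `N`; but here `j < N`.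
    have hv := h.zero N (congrArg Prod.fst hNz)
    rw [hNz, ← length_stack, List.length_eq_zero_iff] at hv
    have := le_of_mem_stack hv (by omega) (List.mem_of_head? hmm.2)
    omega
  · rw [holds_imp, holds_dia_A, holds_dia_A, at_t, holdsAt_dia]
    rintro ⟨n, hn, rfl⟩
    obtain ⟨m, hm, hF⟩ := h.final n
    exact ⟨m + 1, by omega, (at_any _ _).2 ⟨m, rfl, hF⟩⟩
  · rw [holds_imp, holds_dia_A, holds_dia_A, at_t, holdsAt_dia]
    rintro ⟨n, hn, rfl⟩
    obtain ⟨m, hm, hF⟩ := h.label n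
    exact ⟨m + 1, by omega, (at_any _ _).2 ⟨m, rfl, hF⟩⟩
  · simp

theorem satisfiable_runFormula_iff {e : Modality} {b : Bool} (hp : ForbParam e b) (d : Descr) :
    Satisfiable (runFormula (.dir .A) e b d) ↔ d.AcceptsSome := by
  rw [d.acceptsSome_iff]
  constructor
  · rintro ⟨T, _, hT, V, I, H⟩
    exact exists_lazyRun_of_holds hp hT H
  · rintro ⟨τ, h⟩
    exact satisfiable_of_lazyRun hp h

/-! The order dual. -/

/-- The modality that corresponds to a modality in the dual order. -/
def Modality.mirror : Modality → Modality
  | .dir .A => .inv .A | .dir .L => .inv .L | .dir .B => .dir .E | .dir .E => .dir .B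
  | .dir .D => .dir .D | .dir .O => .inv .O | .inv .A => .dir .A | .inv .L => .dir .L
  | .inv .B => .inv .E | .inv .E => .inv .B | .inv .D => .inv .D | .inv .O => .dir .O

/-- Replace all modalities of a formula. -/
def Formula.mapMod (g : Modality → Modality) : Formula → Formula
  | .letter p => .letter p
  | .neg φ => .neg (φ.mapMod g)
  | .or φ ψ => .or (φ.mapMod g) (ψ.mapMod g)
  | .dia X φ => .dia (g X) (φ.mapMod g)

/-- The interval in the dual order. -/
def Interval.dual {T : Type} [LinearOrder T] (I : Interval T) : Interval Tᵒᵈ :=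
  ⟨OrderDual.toDual I.hi, OrderDual.toDual I.lo, I.lo_lt_hi⟩

/-- The interval of the order that is given by an interval of the dual order. -/
def Interval.ofDual {T : Type} [LinearOrder T] (I : Interval Tᵒᵈ) : Interval T :=
  ⟨OrderDual.ofDual I.hi, OrderDual.ofDual I.lo, I.lo_lt_hi⟩

theorem Modality.mirror_rel {T : Type} [LinearOrder T] (X : Modality) (I J : Interval T) :
    X.mirror.Rel I.dual J.dual ↔ X.Rel I J := by
  have h : ∀ a b : T, OrderDual.toDual a = OrderDual.toDual b ↔ a = b := fun _ _ => Iff.rfl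
  rcases X with X | X <;> cases X <;>
    simp only [Modality.mirror, Modality.Rel, Allen.Rel, Interval.dual, OrderDual.toDual_lt_toDual,
      h] <;> tauto

theorem holds_mapMod_mirror {T : Type} [LinearOrder T] (V : ℕ → Set (Interval T)) (φ : Formula)
    (I : Interval T) :
    Holds (fun p => {J | J.ofDual ∈ V p}) I.dual (φ.mapMod Modality.mirror) ↔ Holds V I φ := by
  induction φ generalizing I with
  | letter p => rfl
  | neg φ ih => exact not_congr (ih I)
  | or φ ψ ih1 ih2 => exact or_congr (ih1 I) (ih2 I)
  | dia X φ ih =>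
    constructor
    · rintro ⟨J, hJ, h⟩
      exact ⟨J.ofDual, (X.mirror_rel I J.ofDual).1 hJ, (ih J.ofDual).1 h⟩
    · rintro ⟨J, hJ, h⟩
      exact ⟨J.dual, (X.mirror_rel I J).2 hJ, (ih J).2 h⟩

theorem StronglyDiscrete.dual {T : Type} [LinearOrder T] (h : StronglyDiscrete T) :
    StronglyDiscrete Tᵒᵈ := by
  intro x y hxy
  refine (h _ _ hxy).subset ?_
  rintro z ⟨h1, h2⟩
  exact ⟨h2, h1⟩

theorem Satisfiable.mapMod_mirror {φ : Formula} (h : Satisfiable φ) :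
    Satisfiable (φ.mapMod Modality.mirror) := by
  obtain ⟨T, _, hT, V, I, h⟩ := h
  exact ⟨Tᵒᵈ, inferInstance, hT.dual, _, I.dual, (holds_mapMod_mirror V φ I).2 h⟩

theorem mapMod_mirror_mapMod_mirror (φ : Formula) :
    (φ.mapMod Modality.mirror).mapMod Modality.mirror = φ := by
  induction φ with
  | letter p => rfl
  | neg φ ih => simp [mapMod, ih]
  | or φ ψ ih1 ih2 => simp [mapMod, ih1, ih2]
  | dia X φ ih =>
    have : X.mirror.mirror = X := by rcases X with X | X <;> cases X <;> rfl
    simp [mapMod, ih, this]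

theorem satisfiable_mapMod_mirror_iff (φ : Formula) :
    Satisfiable (φ.mapMod Modality.mirror) ↔ Satisfiable φ :=
  ⟨fun h => mapMod_mirror_mapMod_mirror φ ▸ h.mapMod_mirror, fun h => h.mapMod_mirror⟩

section mapMod

variable (g : Modality → Modality)

theorem mapMod_bigAnd (l : List Formula) :
    (bigAnd l).mapMod g = bigAnd (l.map (mapMod g)) := by
  induction l with
  | nil => rfl
  | cons φ l ih => exact congrArg (Formula.and (φ.mapMod g)) ih

theorem mapMod_anyOf (L : List Trans) : (anyOf L).mapMod g = anyOf L := by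
  induction L with
  | nil => rfl
  | cons t L ih => exact congrArg (Formula.or (tLetter t)) ih

theorem mapMod_forb (e : Modality) (b : Bool) (φ ψ : Formula) :
    (forb e b φ ψ).mapMod g = forb (g e) b (φ.mapMod g) (ψ.mapMod g) := by
  cases b <;> rfl

theorem mapMod_conditions (a e : Modality) (b : Bool) (L : List Trans) (F : List ℕ) (t : Trans) :
    (conditions a e b L F t).mapMod g = conditions (g a) (g e) b L F t := by
  simp only [conditions, mapMod_bigAnd, List.map_cons, List.map_nil, mapMod_forb, imp, box, mapMod,
    anyInstr, mapMod_anyOf, Formula.and, tLetter, uLetter, mLetter]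

/-- The modalities enter only as parameters and letters are untouched, so the mirrored formula is an
instance of the same construction and inherits its computability. -/
theorem mapMod_runFormula (a e : Modality) (b : Bool) (d : Descr) :
    (runFormula a e b d).mapMod g = runFormula (g a) (g e) b d := by
  simp only [runFormula, globally, Formula.and, box, mapMod, mapMod_anyOf, mapMod_bigAnd,
    List.map_map, Function.comp_def, mapMod_conditions]

end mapMod

end HS

namespace HS

open ICA Formula

/-! Computability of the formulas. -/

theorem primrec_letter : Primrec Formula.letter :=
  Primrec.encode_iff.1 (Primrec.nat_mul.comp (Primrec.const 15) Primrec.id)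

theorem primrec_neg : Primrec Formula.neg :=
  Primrec.encode_iff.1 (Primrec.nat_add.comp
    (Primrec.nat_mul.comp (Primrec.const 15) Primrec.encode) (Primrec.const 1))

theorem primrec_or : Primrec₂ Formula.or :=
  Primrec₂.encode_iff.1 (Primrec.nat_add.comp
    (Primrec.nat_mul.comp (Primrec.const 15)
      (Primrec₂.natPair.comp (Primrec.encode.comp Primrec.fst) (Primrec.encode.comp Primrec.snd)))
    (Primrec.const 2)).to₂

theorem primrec_dia (X : Modality) : Primrec (Formula.dia X) :=
  Primrec.encode_iff.1 (Primrec.nat_add.comp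
    (Primrec.nat_mul.comp (Primrec.const 15) Primrec.encode) (Primrec.const (X.toFin.val + 3)))

theorem primrec_and : Primrec₂ Formula.and :=
  (primrec_neg.comp (primrec_or.comp (primrec_neg.comp Primrec.fst)
    (primrec_neg.comp Primrec.snd))).to₂

theorem primrec_imp : Primrec₂ Formula.imp :=
  (primrec_or.comp (primrec_neg.comp Primrec.fst) Primrec.snd).to₂

theorem primrec_box (X : Modality) : Primrec (Formula.box X) :=
  primrec_neg.comp ((primrec_dia X).comp primrec_neg)

theorem primrec_bigAnd : Primrec bigAnd :=
  Primrec.list_foldr Primrec.id (Primrec.const top)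
    (primrec_and.comp (Primrec.fst.comp Primrec.snd) (Primrec.snd.comp Primrec.snd)).to₂

theorem primrec_bigOr : Primrec bigOr :=
  Primrec.list_foldr Primrec.id (Primrec.const bot)
    (primrec_or.comp (Primrec.fst.comp Primrec.snd) (Primrec.snd.comp Primrec.snd)).to₂

theorem primrec_globally (a : Modality) : Primrec (globally a) :=
  primrec_and.comp Primrec.id (primrec_and.comp (primrec_box a)
    ((primrec_box a).comp (primrec_box a)))

theorem primrec_forb (e : Modality) (b : Bool) : Primrec₂ (forb e b) := by
  cases b
  · exact (primrec_imp.comp Primrec.snd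
      ((primrec_box e).comp (primrec_neg.comp Primrec.fst))).to₂
  · exact (primrec_imp.comp Primrec.fst
      ((primrec_box e).comp (primrec_neg.comp Primrec.snd))).to₂

theorem primrec_tLetter : Primrec tLetter :=
  primrec_letter.comp (Primrec.nat_mul.comp (Primrec.const 3) Primrec.encode)

theorem primrec_mLetter : Primrec mLetter :=
  primrec_letter.comp (Primrec.succ.comp (Primrec.nat_mul.comp (Primrec.const 3) Primrec.id))

theorem primrec_anyOf : Primrec anyOf :=
  primrec_bigOr.comp (Primrec.list_map Primrec.id (primrec_tLetter.comp Primrec.snd).to₂)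

section filter

variable {γ : Type} [Primcodable γ]

theorem primrec_anyOf_filter {f : γ → List Trans} (hf : Primrec f) {R : Trans → γ → Prop}
    [DecidableRel R] (hR : PrimrecRel R) :
    Primrec fun c => anyOf ((f c).filter fun t => R t c) :=
  primrec_anyOf.comp (hR.listFilter.comp hf Primrec.id)

theorem primrec_anyInstr {f : γ → List Trans} (hf : Primrec f) {l : γ → Op × ℕ} (hl : Primrec l) :
    Primrec fun c => anyInstr (f c) (l c) :=
  primrec_anyOf_filter hf (R := fun t c => t.2.2.1 = l c)
    (Primrec.eq.comp (Primrec.fst.comp (Primrec.snd.comp (Primrec.snd.comp Primrec.fst)))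
      (hl.comp Primrec.snd))

end filter

theorem primrecRel_mem_list : PrimrecRel fun (n : ℕ) (l : List ℕ) => n ∈ l := by
  have h : PrimrecRel fun (l : List ℕ) (n : ℕ) => ∃ a ∈ l, a = n :=
    PrimrecRel.exists_mem_list Primrec.eq
  exact (h.comp Primrec.snd Primrec.fst).of_eq fun p => by simp

theorem primrec_list_bigAnd {γ : Type} [Primcodable γ] {l : γ → List Formula} (h : Primrec l) :
    Primrec fun c => bigAnd (l c) := primrec_bigAnd.comp h

theorem primrec_conditions (a e : Modality) (b : Bool) :
    Primrec fun c : (List Trans × List ℕ) × Trans => conditions a e b c.1.1 c.1.2 c.2 := by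
  have hL : Primrec fun c : (List Trans × List ℕ) × Trans => c.1.1 := Primrec.fst.comp Primrec.fst
  have hF : Primrec fun c : (List Trans × List ℕ) × Trans => c.1.2 := Primrec.snd.comp Primrec.fst
  have ht : Primrec fun c : (List Trans × List ℕ) × Trans => tLetter c.2 :=
    primrec_tLetter.comp Primrec.snd
  have hi : Primrec fun c : (List Trans × List ℕ) × Trans => c.2.2.2.1.2 :=
    Primrec.snd.comp (Primrec.fst.comp (Primrec.snd.comp (Primrec.snd.comp Primrec.snd)))
  have hm : Primrec fun c : (List Trans × List ℕ) × Trans => mLetter c.2.2.2.1.2 :=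
    primrec_mLetter.comp hi
  have hd : ∀ {f : (List Trans × List ℕ) × Trans → Formula}, Primrec f →
      Primrec fun c => dia a (f c) := fun h => (primrec_dia a).comp h
  have hins : ∀ o : Op, Primrec fun c : (List Trans × List ℕ) × Trans =>
      anyInstr c.1.1 (o, c.2.2.2.1.2) := fun o => primrec_anyInstr hL ((Primrec.const o).pair hi)
  refine primrec_list_bigAnd (Primrec.list_cons.comp ?_ <| Primrec.list_cons.comp ?_ <|
    Primrec.list_cons.comp ?_ <| Primrec.list_cons.comp ?_ <| Primrec.list_cons.comp ?_ <|
    Primrec.list_cons.comp ?_ <| Primrec.list_cons.comp ?_ <| Primrec.list_cons.comp ?_ <|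
    Primrec.list_cons.comp ?_ (Primrec.const []))
  · exact primrec_imp.comp (hd ht) ((primrec_box a).comp ht)
  · refine primrec_imp.comp ht (primrec_neg.comp (primrec_anyOf_filter hL
      (R := fun t c => t ≠ c.2) ?_))
    exact PrimrecPred.not (Primrec.eq.comp Primrec.fst (Primrec.snd.comp Primrec.snd))
  · refine primrec_imp.comp (hd ht) (hd (primrec_and.comp (Primrec.const _) (hd
      (primrec_anyOf_filter hL (R := fun t c => t.1 = c.2.2.2.2) ?_))))
    exact Primrec.eq.comp (Primrec.fst.comp Primrec.fst)
      (Primrec.snd.comp (Primrec.snd.comp (Primrec.snd.comp (Primrec.snd.comp Primrec.snd))))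
  · exact (primrec_forb e b).comp (Primrec.const _) ht
  · exact (primrec_forb e b).comp hm hm
  · exact primrec_imp.comp (primrec_and.comp (hd (hins .inc)) (hd (hd (hins .ifz))))
      (hd (primrec_and.comp hm (hd (hins .dec))))
  · exact (primrec_forb e b).comp hm (hins .ifz)
  · refine primrec_imp.comp (hd ht) (hd (hd (primrec_anyOf_filter hL
      (R := fun t c => t.1 ∈ c.1.2) ?_)))
    exact primrecRel_mem_list.comp (Primrec.fst.comp Primrec.fst)
      (Primrec.snd.comp (Primrec.fst.comp Primrec.snd))
  · refine primrec_imp.comp (hd ht) (hd (hd (primrec_anyOf_filter hL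
      (R := fun t c => t.2.1 ≠ none) ?_)))
    exact PrimrecPred.not (Primrec.eq.comp (Primrec.fst.comp (Primrec.snd.comp Primrec.fst))
      (Primrec.const none))

theorem primrecRel_inRange : PrimrecRel fun (t : Trans) (d : Descr) => d.InRange t := by
  have h2 : PrimrecRel fun (t : Trans) (d : Descr) => ∀ a ∈ t.2.1, a < d.2.1 := by
    have h : Primrec fun c : Trans × Descr => Option.casesOn (motive := fun _ => Bool) c.1.2.1 true
        (fun a => decide (a < c.2.2.1)) :=
      Primrec.option_casesOn (Primrec.fst.comp (Primrec.snd.comp Primrec.fst)) (Primrec.const true)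
        (PrimrecPred.decide (Primrec.nat_lt.comp Primrec.snd
          (Primrec.fst.comp (Primrec.snd.comp (Primrec.snd.comp Primrec.fst)))))
    refine (Primrec.eq.comp h (Primrec.const true)).of_eq ?_
    rintro ⟨⟨q, a, l, q'⟩, d⟩
    cases a <;> simp
  exact PrimrecPred.and
    (Primrec.nat_le.comp (Primrec.fst.comp Primrec.fst) (Primrec.fst.comp Primrec.snd))
    (PrimrecPred.and h2 (PrimrecPred.and
      (Primrec.nat_lt.comp
        (Primrec.snd.comp (Primrec.fst.comp (Primrec.snd.comp (Primrec.snd.comp Primrec.fst))))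
        (Primrec.fst.comp (Primrec.snd.comp (Primrec.snd.comp Primrec.snd))))
      (Primrec.nat_le.comp
        (Primrec.snd.comp (Primrec.snd.comp (Primrec.snd.comp Primrec.fst)))
        (Primrec.fst.comp Primrec.snd))))

theorem primrec_validTrans : Primrec validTrans :=
  primrecRel_inRange.listFilter.comp
    (Primrec.fst.comp (Primrec.snd.comp (Primrec.snd.comp Primrec.snd))) Primrec.id

theorem primrec_runFormula (a e : Modality) (b : Bool) : Primrec (runFormula a e b) := by
  refine primrec_and.comp ((primrec_dia a).comp (primrec_anyOf_filter primrec_validTrans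
    (R := fun t d => t.1 = 0) (Primrec.eq.comp (Primrec.fst.comp Primrec.fst) (Primrec.const 0))))
    ((primrec_globally a).comp (primrec_bigAnd.comp (Primrec.list_map primrec_validTrans ?_)))
  exact ((primrec_conditions a e b).comp (((primrec_validTrans.comp Primrec.fst).pair
    (Primrec.snd.comp (Primrec.snd.comp (Primrec.snd.comp (Primrec.snd.comp Primrec.fst))))).pair
    Primrec.snd)).to₂

/-! Membership in the fragments. -/

section fragment

variable {S : Set Modality}

theorem mem_fragment_dia {X : Modality} {φ : Formula} (hX : X ∈ S) (h : φ ∈ Fragment S) :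
    dia X φ ∈ Fragment S := ⟨hX, h⟩

theorem mem_fragment_and {φ ψ : Formula} (h : φ ∈ Fragment S) (h' : ψ ∈ Fragment S) :
    φ.and ψ ∈ Fragment S := ⟨h, h'⟩

theorem mem_fragment_imp {φ ψ : Formula} (h : φ ∈ Fragment S) (h' : ψ ∈ Fragment S) :
    φ.imp ψ ∈ Fragment S := ⟨h, h'⟩

theorem mem_fragment_box {X : Modality} {φ : Formula} (hX : X ∈ S) (h : φ ∈ Fragment S) :
    φ.box X ∈ Fragment S := ⟨hX, h⟩

theorem mem_fragment_top : top ∈ Fragment S := ⟨trivial, trivial⟩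

theorem mem_fragment_bigAnd {l : List Formula} (h : ∀ φ ∈ l, φ ∈ Fragment S) :
    bigAnd l ∈ Fragment S := by
  induction l with
  | nil => exact mem_fragment_top
  | cons φ l ih =>
    rw [List.forall_mem_cons] at h
    exact mem_fragment_and h.1 (ih h.2)

theorem mem_fragment_anyOf (L : List Trans) : anyOf L ∈ Fragment S := by
  induction L with
  | nil => exact mem_fragment_top
  | cons t L ih => exact ⟨trivial, ih⟩

theorem mem_fragment_forb {e : Modality} {b : Bool} {φ ψ : Formula} (he : e ∈ S)
    (h : φ ∈ Fragment S) (h' : ψ ∈ Fragment S) : forb e b φ ψ ∈ Fragment S := by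
  cases b
  · exact mem_fragment_imp h' (mem_fragment_box he h)
  · exact mem_fragment_imp h (mem_fragment_box he h')

theorem runFormula_mem_fragment {a e : Modality} (ha : a ∈ S) (he : e ∈ S) (b : Bool) (d : Descr) :
    runFormula a e b d ∈ Fragment S := by
  have ht : ∀ t, tLetter t ∈ Fragment S := fun _ => trivial
  have hm : ∀ i, mLetter i ∈ Fragment S := fun _ => trivial
  have hu : uLetter ∈ Fragment S := trivial
  have hc : ∀ L F t, conditions a e b L F t ∈ Fragment S := by
    intro L F t
    refine mem_fragment_bigAnd ?_
    simp only [List.forall_mem_cons]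
    have hany : ∀ L, anyOf L ∈ Fragment S := mem_fragment_anyOf
    have hins : ∀ l, anyInstr L l ∈ Fragment S := fun _ => hany _
    have hd : ∀ {φ}, φ ∈ Fragment S → dia a φ ∈ Fragment S := mem_fragment_dia ha
    refine ⟨mem_fragment_imp (hd (ht _)) (mem_fragment_box ha (ht _)),
      mem_fragment_imp (ht _) (hany _),
      mem_fragment_imp (hd (ht _)) (hd (mem_fragment_and hu (hd (hany _)))),
      mem_fragment_forb he hu (ht _), mem_fragment_forb he (hm _) (hm _),
      mem_fragment_imp (mem_fragment_and (hd (hins _)) (hd (hd (hins _))))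
        (hd (mem_fragment_and (hm _) (hd (hins _)))),
      mem_fragment_forb he (hm _) (hins _), mem_fragment_imp (hd (ht _)) (hd (hd (hany _))),
      mem_fragment_imp (hd (ht _)) (hd (hd (hany _))), by simp⟩
  have hG : bigAnd ((validTrans d).map (conditions a e b (validTrans d) d.2.2.2.2)) ∈
      Fragment S := by
    refine mem_fragment_bigAnd fun φ hφ => ?_
    obtain ⟨t, -, rfl⟩ := List.mem_map.1 hφ
    exact hc _ _ _
  exact mem_fragment_and (mem_fragment_dia ha (mem_fragment_anyOf _))
    (mem_fragment_and hG (mem_fragment_and (mem_fragment_box ha hG)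
      (mem_fragment_box ha (mem_fragment_box ha hG))))

end fragment

end HS

/-! ### The four reductions -/

open HS in
theorem nonemptinessReducesTo_of_forbParam {e : Modality} {b : Bool} (hp : ForbParam e b) :
    NonemptinessReducesTo {.dir .A, e} :=
  ⟨runFormula (.dir .A) e b, (primrec_runFormula _ e b).to_comp, fun d =>
    ⟨runFormula_mem_fragment (by simp) (by simp) b d, satisfiable_runFormula_iff hp d⟩⟩

-- Reversal of the order preserves strong discreteness, so the mirrored formula is satisfiable
-- together with the original one.
open HS in
theorem nonemptinessReducesTo_mirror_of_forbParam {e : Modality} {b : Bool} (hp : ForbParam e b) :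
    NonemptinessReducesTo {.inv .A, e.mirror} := by
  refine ⟨runFormula (.inv .A) e.mirror b, (primrec_runFormula _ _ b).to_comp, fun d =>
    ⟨runFormula_mem_fragment (by simp) (by simp) b d, ?_⟩⟩
  rw [← satisfiable_runFormula_iff hp d, ← satisfiable_mapMod_mirror_iff (runFormula (.dir .A) e b d),
    mapMod_runFormula]
  rfl

namespace ICA

/-! Counter machines without errors and their simulation with bounded resources. -/

/-- A counter machine: a bound on the states, the number of counters, and the instructions. The
initial state is `0`. -/
abbrev Machine : Type := ℕ × ℕ × List (ℕ × (Op × ℕ) × ℕ)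

/-- Exact step of a counter machine. -/
def Machine.Step (P : Machine) (c c' : ℕ × (ℕ → ℕ)) : Prop :=
  ∃ l, (c.1, l, c'.1) ∈ P.2.2 ∧ Exec l c.2 c'.2

/-- Configurations reached in a given number of steps. -/
inductive Machine.Reach (P : Machine) : ℕ → ℕ × (ℕ → ℕ) → Prop
  | zero : Reach P 0 (0, 0)
  | succ {m : ℕ} {c c' : ℕ × (ℕ → ℕ)} : Reach P m c → P.Step c c' → Reach P (m + 1) c'

/-- The machine respects its bounds. -/
def Machine.WellFormed (P : Machine) : Prop :=
  ∀ t ∈ P.2.2, t.1 ≤ P.1 ∧ t.2.1.2 < P.2.1 ∧ t.2.2 ≤ P.1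

theorem Machine.Reach.of_le {P : Machine} {m n : ℕ} {c : ℕ × (ℕ → ℕ)} (h : P.Reach n c)
    (hmn : m ≤ n) : ∃ c', P.Reach m c' := by
  induction h with
  | zero =>
    obtain rfl := Nat.le_zero.1 hmn
    exact ⟨_, Reach.zero⟩
  | succ h hs ih =>
    rcases hmn.eq_or_lt with rfl | h'
    · exact ⟨_, h.succ hs⟩
    · exact ih (Nat.lt_succ_iff.1 h')

theorem Exec.eq_update {l : Op × ℕ} {v v' : ℕ → ℕ} (h : Exec l v v') :
    v' = Function.update v l.2 (l.1.apply (v l.2)) := by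
  obtain ⟨o, i⟩ := l
  funext j
  by_cases hj : j = i
  · subst hj
    have := h.2
    cases o <;> simp [Op.apply] at this ⊢ <;> omega
  · simp only [ne_eq, hj, not_false_iff, Function.update_of_ne]
    exact h.1 j hj

theorem exec_update {l : Op × ℕ} {v : ℕ → ℕ} (hd : l.1 = .dec → v l.2 ≠ 0)
    (hz : l.1 = .ifz → v l.2 = 0) : Exec l v (Function.update v l.2 (l.1.apply (v l.2))) := by
  obtain ⟨o, i⟩ := l
  refine ⟨fun j hj => Function.update_of_ne hj _ _, ?_⟩
  cases o <;> simp [Op.apply] at hd hz ⊢ <;> omega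

/-! ### The automaton that simulates a machine on a budget -/

/-- Control states of the automaton that simulates a machine. -/
inductive Ctl
  | fin | move | move' | round | round' | mid
  | test (j : ℕ) | sim (p : ℕ) | store (p : ℕ) | pay (p : ℕ) | shift (p : ℕ)
deriving DecidableEq

/-- Numbers of the control states. -/
def Ctl.code : Ctl → ℕ
  | .fin => 0 | .move => 1 | .move' => 2 | .round => 3 | .round' => 4 | .mid => 6
  | .test j => 6 * j + 5 | .sim p => 6 * p + 7 | .store p => 6 * p + 8 | .pay p => 6 * p + 9
  | .shift p => 6 * p + 10

theorem Ctl.code_injective : Function.Injective Ctl.code := by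
  intro s s' h
  cases s <;> cases s' <;> simp only [Ctl.code] at h <;> first | rfl | omega | (congr 1; omega)

/-- The control state after the simulation of an instruction. -/
def Op.next : Op → ℕ → Ctl
  | .inc, p => .pay p
  | .dec, p => .store p
  | .ifz, p => .shift p

/-- Transitions of the automaton that simulates a machine. Counter `0` is the budget, counter `1`
saves the budget of the rounds, counter `2` takes the used budget, and counter `i + 3` simulates
counter `i`. -/
inductive Rule (P : Machine) : Ctl → Op × ℕ → Ctl → Prop
  | fin : Rule P .fin (.inc, 0) .move
  | moveDec : Rule P .move (.dec, 1) .move'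
  | moveInc : Rule P .move' (.inc, 0) .move
  | moveEnd : Rule P .move (.ifz, 1) .round
  | roundEnd : Rule P .round (.ifz, 0) .fin
  | roundDec : Rule P .round (.dec, 0) .round'
  | roundInc : Rule P .round' (.inc, 1) (.sim 0)
  | refill : Rule P .mid (.inc, 0) (.test 0)
  | abort {t : ℕ × (Op × ℕ) × ℕ} (h : t ∈ P.2.2) : Rule P (.sim t.1) (.ifz, 0) (.test 0)
  | exec {t : ℕ × (Op × ℕ) × ℕ} (h : t ∈ P.2.2) :
      Rule P (.sim t.1) (t.2.1.1, t.2.1.2 + 3) (t.2.1.1.next t.2.2)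
  | store {t : ℕ × (Op × ℕ) × ℕ} (h : t ∈ P.2.2) : Rule P (.store t.2.2) (.inc, 2) (.sim t.2.2)
  | pay {t : ℕ × (Op × ℕ) × ℕ} (h : t ∈ P.2.2) : Rule P (.pay t.2.2) (.dec, 0) (.sim t.2.2)
  | shift {t : ℕ × (Op × ℕ) × ℕ} (h : t ∈ P.2.2) : Rule P (.shift t.2.2) (.dec, 0) (.store t.2.2)
  | drain {j : ℕ} (h : j < P.2.1 + 1) : Rule P (.test 0) (.dec, j + 2) .mid
  | test {j : ℕ} (h : j < P.2.1) : Rule P (.test j) (.ifz, j + 2) (.test (j + 1))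
  | testEnd : Rule P (.test P.2.1) (.ifz, P.2.1 + 2) .round

/-- A transition between control states. -/
def ctlTrans (s : Ctl) (l : Op × ℕ) (s' : Ctl) : Trans := (s.code, some 0, l, s'.code)

/-- The transitions that are the same for all machines. -/
def commonTrans : List Trans :=
  [ctlTrans .fin (.inc, 0) .move, ctlTrans .move (.dec, 1) .move', ctlTrans .move' (.inc, 0) .move,
    ctlTrans .move (.ifz, 1) .round, ctlTrans .round (.ifz, 0) .fin,
    ctlTrans .round (.dec, 0) .round', ctlTrans .round' (.inc, 1) (.sim 0),
    ctlTrans .mid (.inc, 0) (.test 0)]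

/-- The transitions for one instruction of the machine. -/
def instrTrans (t : ℕ × (Op × ℕ) × ℕ) : List Trans :=
  [ctlTrans (.sim t.1) (.ifz, 0) (.test 0),
    ctlTrans (.sim t.1) (t.2.1.1, t.2.1.2 + 3) (t.2.1.1.next t.2.2),
    ctlTrans (.store t.2.2) (.inc, 2) (.sim t.2.2), ctlTrans (.pay t.2.2) (.dec, 0) (.sim t.2.2),
    ctlTrans (.shift t.2.2) (.dec, 0) (.store t.2.2)]

/-- The description of the automaton that simulates a machine. -/
def Machine.descr (P : Machine) : Descr :=
  (6 * (P.1 + P.2.1) + 11, 1, P.2.1 + 3,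
    ctlTrans (.test P.2.1) (.ifz, P.2.1 + 2) .round :: (commonTrans ++ (P.2.2.flatMap instrTrans ++
      ((List.range (P.2.1 + 1)).map (fun j => ctlTrans (.test 0) (.dec, j + 2) .mid) ++
      (List.range P.2.1).map (fun j => ctlTrans (.test j) (.ifz, j + 2) (.test (j + 1)))))), [0])

theorem Machine.mem_descr_iff {P : Machine} {t : Trans} :
    t ∈ P.descr.2.2.2.1 ↔ ∃ s l s', Rule P s l s' ∧ t = ctlTrans s l s' := by
  constructor
  · intro h
    simp only [descr, List.mem_cons, List.mem_append, List.mem_flatMap, List.mem_map,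
      List.mem_range, commonTrans, instrTrans, List.not_mem_nil, or_false] at h
    rcases h with rfl | h | ⟨t', ht', h⟩ | ⟨j, hj, rfl⟩ | ⟨j, hj, rfl⟩
    · exact ⟨_, _, _, .testEnd, rfl⟩
    · rcases h with rfl | rfl | rfl | rfl | rfl | rfl | rfl | rfl
      exacts [⟨_, _, _, .fin, rfl⟩, ⟨_, _, _, .moveDec, rfl⟩, ⟨_, _, _, .moveInc, rfl⟩,
        ⟨_, _, _, .moveEnd, rfl⟩, ⟨_, _, _, .roundEnd, rfl⟩, ⟨_, _, _, .roundDec, rfl⟩,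
        ⟨_, _, _, .roundInc, rfl⟩, ⟨_, _, _, .refill, rfl⟩]
    · rcases h with rfl | rfl | rfl | rfl | rfl
      exacts [⟨_, _, _, .abort ht', rfl⟩, ⟨_, _, _, .exec ht', rfl⟩, ⟨_, _, _, .store ht', rfl⟩,
        ⟨_, _, _, .pay ht', rfl⟩, ⟨_, _, _, .shift ht', rfl⟩]
    · exact ⟨_, _, _, .drain hj, rfl⟩
    · exact ⟨_, _, _, .test hj, rfl⟩
  · rintro ⟨s, l, s', h, rfl⟩
    simp only [descr, List.mem_cons, List.mem_append, List.mem_flatMap, List.mem_map,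
      List.mem_range, commonTrans, instrTrans, List.not_mem_nil, or_false]
    cases h with
    | abort h => exact Or.inr (Or.inr (Or.inl ⟨_, h, by simp⟩))
    | exec h => exact Or.inr (Or.inr (Or.inl ⟨_, h, by simp⟩))
    | store h => exact Or.inr (Or.inr (Or.inl ⟨_, h, by simp⟩))
    | pay h => exact Or.inr (Or.inr (Or.inl ⟨_, h, by simp⟩))
    | shift h => exact Or.inr (Or.inr (Or.inl ⟨_, h, by simp⟩))
    | drain h => exact Or.inr (Or.inr (Or.inr (Or.inl ⟨_, h, rfl⟩)))
    | test h => exact Or.inr (Or.inr (Or.inr (Or.inr ⟨_, h, rfl⟩)))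
    | testEnd => exact Or.inl rfl
    | _ => exact Or.inr (Or.inl (by simp))

/-- The sum of all counters but the one that saves the budget. -/
def total (k : ℕ) (v : ℕ → ℕ) : ℕ := v 0 + ∑ j ∈ Finset.range (k + 1), v (j + 2)

theorem total_update {k : ℕ} (v : ℕ → ℕ) {i : ℕ} (x : ℕ) (hi : i ≠ 1) (hk : i < k + 3) :
    total k (Function.update v i x) + v i = total k v + x := by
  unfold total
  rcases Nat.eq_zero_or_pos i with rfl | h0
  · simp
    omega
  · obtain ⟨j, rfl⟩ : ∃ j, i = j + 2 := ⟨i - 2, by omega⟩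
    have hj : j ∈ Finset.range (k + 1) := Finset.mem_range.2 (by omega)
    have h : ∀ m, Function.update v (j + 2) x (m + 2) =
        Function.update (fun m => v (m + 2)) j x m := by
      intro m
      simp [Function.update_apply]
    simp only [h, Finset.sum_update_of_mem hj]
    rw [← Finset.add_sum_erase _ (fun m => v (m + 2)) hj, Finset.sdiff_singleton_eq_erase]
    simp only [Function.update_apply, if_neg (show 0 ≠ j + 2 by omega)]
    omega

theorem total_update_one {k : ℕ} (v : ℕ → ℕ) (x : ℕ) :
    total k (Function.update v 1 x) = total k v := by
  simp [total]

theorem total_eq_of_clean {k : ℕ} {v : ℕ → ℕ} (h : ∀ j < k + 1, v (j + 2) = 0) :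
    total k v = v 0 := by
  rw [total, Finset.sum_eq_zero fun j hj => h j (Finset.mem_range.1 hj), add_zero]

end ICA

/-! ### Invariants: machines without long computations give empty automata -/

namespace ICA

/-- The counters that are used in a simulation are empty. -/
def Clean (k : ℕ) (v : ℕ → ℕ) : Prop := ∀ j < k + 1, v (j + 2) = 0

/-- At least `b` units are distributed over all counters. -/
def AllBound (k b : ℕ) (v : ℕ → ℕ) : Ctl → Prop
  | .fin => Clean k v ∧ b ≤ total k v + v 1
  | .move => Clean k v ∧ b ≤ total k v + v 1
  | .move' => Clean k v ∧ b ≤ total k v + v 1 + 1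
  | .round => Clean k v ∧ b ≤ total k v + v 1
  | .round' => Clean k v ∧ b ≤ total k v + v 1 + 1
  | .mid => b ≤ total k v + v 1 + 1
  | .test j => b ≤ total k v + v 1 ∧ ∀ i < j, v (i + 2) = 0
  | .sim _ => b ≤ total k v + v 1
  | .store _ => b ≤ total k v + v 1 + 1
  | .pay _ => b + 1 ≤ total k v + v 1
  | .shift _ => b ≤ total k v + v 1

/-- The simulated counters are those of a configuration that is reached in `m` steps. -/
def Faithful (P : Machine) (v : ℕ → ℕ) (m p : ℕ) : Prop :=
  ∃ u, P.Reach m (p, u) ∧ ∀ i < P.2.1, v (i + 3) = u i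

/-- The budget `b` has not been used up, or the simulation has been exact so far. -/
def BudgetBound (P : Machine) (b : ℕ) (v : ℕ → ℕ) : Ctl → Prop
  | .fin => False
  | .move => Clean P.2.1 v ∧ b ≤ v 0 + v 1
  | .move' => Clean P.2.1 v ∧ b ≤ v 0 + v 1 + 1
  | .round => Clean P.2.1 v ∧ b ≤ v 0
  | .round' => Clean P.2.1 v ∧ b ≤ v 0 + 1
  | .mid => b ≤ total P.2.1 v + 1
  | .test j => b ≤ total P.2.1 v ∧ ∀ i < j, v (i + 2) = 0
  | .sim p => b ≤ total P.2.1 v ∨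
      (b ≤ total P.2.1 v + 1 ∧ ∃ m, Faithful P v m p ∧ b ≤ v 0 + m + 1)
  | .store p => b ≤ total P.2.1 v + 1 ∨
      (b ≤ total P.2.1 v + 2 ∧ ∃ m, Faithful P v m p ∧ b ≤ v 0 + m + 1)
  | .pay p => b + 1 ≤ total P.2.1 v ∨
      (b ≤ total P.2.1 v ∧ ∃ m, Faithful P v (m + 1) p ∧ b ≤ v 0 + m + 1)
  | .shift p => b ≤ total P.2.1 v ∨
      (b ≤ total P.2.1 v + 1 ∧ ∃ m, Faithful P v (m + 1) p ∧ b ≤ v 0 + m + 1)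

section step

variable {P : Machine} {s s' : Ctl} {l : Op × ℕ} {v : ℕ → ℕ} {b : ℕ}

theorem Clean.update {k : ℕ} (h : Clean k v) {i : ℕ} (hi : i < 2) (x : ℕ) :
    Clean k (Function.update v i x) := by
  intro j hj
  rw [Function.update_of_ne (by omega)]
  exact h j hj

theorem AllBound.mono {k b' : ℕ} (hb : b ≤ b') (h : AllBound k b' v s) : AllBound k b v s := by
  cases s <;> simp only [AllBound] at h ⊢ <;>
    first | omega | exact ⟨h.1, by omega⟩ | exact ⟨by omega, h.2⟩

/-- The cycles of the control only move units between counters, apart from the unit added at `fin`,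
and truncated decrements can only add more. The corrections by one belong to states between the two
halves of a move. The `test` states record the counters already found empty, which adds up to
`Clean` when `round` is entered again. -/
theorem AllBound.step (hr : Rule P s l s') (hl : l.2 < P.2.1 + 3)
    (hz : l.1 = .ifz → v l.2 = 0) (h : AllBound P.2.1 b v s) :
    AllBound P.2.1 (if s = .fin then b + 1 else b)
      (Function.update v l.2 (l.1.apply (v l.2))) s' := by
  have h1 := total_update_one (k := P.2.1) v (l.1.apply (v 1))
  have h2 := fun hi => total_update (k := P.2.1) v (l.1.apply (v l.2)) (i := l.2) hi hl
  cases hr with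
  | fin | roundEnd | moveInc | moveDec | moveEnd | roundDec =>
    simp only [AllBound, Op.apply, reduceCtorEq, if_true, if_false] at h h1 h2 ⊢
    refine ⟨h.1.update (by norm_num) _, ?_⟩
    simp at hz h1 h2 h ⊢
    omega
  | roundInc =>
    simp [AllBound, Op.apply] at h h1 ⊢
    omega
  | refill =>
    simp [AllBound, Op.apply] at h h2 ⊢
    omega
  | abort ht =>
    simp [AllBound, Op.apply] at h h2 ⊢
    omega
  | @exec t ht =>
    obtain ⟨p, ⟨o, i⟩, p'⟩ := t
    cases o <;> simp [AllBound, Op.apply, Op.next] at hz h h2 ⊢ <;> omega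
  | store ht | pay ht | shift ht =>
    simp [AllBound, Op.apply] at h h2 ⊢
    omega
  | drain hj =>
    simp [AllBound, Op.apply] at h h2 ⊢
    omega
  | @test j hj =>
    simp only [forall_const] at hz
    simp only [Op.apply, Function.update_eq_self]
    simp only [AllBound, reduceCtorEq, if_false] at h ⊢
    refine ⟨h.1, fun i hi => ?_⟩
    rcases Nat.lt_succ_iff_lt_or_eq.1 hi with hi | rfl
    · exact h.2 i hi
    · exact hz
  | testEnd =>
    simp only [forall_const] at hz
    simp only [Op.apply, Function.update_eq_self]
    simp only [AllBound, reduceCtorEq, if_false] at h ⊢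
    refine ⟨fun i hi => ?_, h.1⟩
    rcases Nat.lt_succ_iff_lt_or_eq.1 hi with hi | rfl
    · exact h.2 i hi
    · exact hz

theorem Faithful.update {m p : ℕ} (h : Faithful P v m p) {i : ℕ} (hi : i < 3) (x : ℕ) :
    Faithful P (Function.update v i x) m p := by
  obtain ⟨u, hu, h⟩ := h
  refine ⟨u, hu, fun j hj => ?_⟩
  rw [Function.update_of_ne (by omega)]
  exact h j hj

theorem Faithful.exec {m p p' i : ℕ} {o : Op} (h : Faithful P v m p) (hi : i < P.2.1)
    (ht : (p, (o, i), p') ∈ P.2.2) (hd : o = .dec → v (i + 3) ≠ 0)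
    (hz : o = .ifz → v (i + 3) = 0) :
    Faithful P (Function.update v (i + 3) (o.apply (v (i + 3)))) (m + 1) p' := by
  obtain ⟨u, hu, h⟩ := h
  have hui := h i hi
  refine ⟨Function.update u i (o.apply (u i)), hu.succ ⟨_, ht, exec_update (l := (o, i)) ?_ ?_⟩, ?_⟩
  · exact fun ho hu0 => hd ho (hui.trans hu0)
  · exact fun ho => hui.symm.trans (hz ho)
  · intro j hj
    by_cases hji : j = i
    · subst hji; simp [hui]
    · rw [Function.update_of_ne (by omega), Function.update_of_ne hji]
      exact h j hj

/-- The unit taken by `roundDec` is missing throughout the simulation unless a truncated decrement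
replaces it: these are the two alternatives in the `sim` states. As long as nothing is replaced the
simulation is exact, and exact simulations are too short to exhaust the budget. So the loss is made
up before the next `round`, and `roundEnd` never becomes possible. -/
theorem BudgetBound.step (hb : 0 < b) (hP : ∀ m c, P.Reach m c → m + 1 < b)
    (hr : Rule P s l s') (hl : l.2 < P.2.1 + 3)
    (hz : l.1 = .ifz → v l.2 = 0) (h : BudgetBound P b v s) :
    BudgetBound P b (Function.update v l.2 (l.1.apply (v l.2))) s' := by
  have h1 := total_update_one (k := P.2.1) v (l.1.apply (v 1))
  have h2 := fun hi => total_update (k := P.2.1) v (l.1.apply (v l.2)) (i := l.2) hi hl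
  have hF : ∀ {m p}, Faithful P v m p → m + 1 < b := fun ⟨_, h, _⟩ => hP _ _ h
  cases hr with
  | fin => exact h.elim
  | roundEnd =>
    have := h.2
    simp at hz
    omega
  | moveInc | moveDec | moveEnd | roundDec =>
    simp only [BudgetBound, Op.apply] at h h1 h2 ⊢
    refine ⟨h.1.update (by norm_num) _, ?_⟩
    simp at hz h ⊢
    omega
  | roundInc =>
    simp only [BudgetBound] at h ⊢
    refine Or.inr ⟨?_, 0, ⟨0, Machine.Reach.zero, fun i hi => ?_⟩, ?_⟩
    · rw [h1, total_eq_of_clean h.1]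
      exact h.2
    · rw [Function.update_of_ne (by omega)]
      exact h.1 (i + 1) (by omega)
    · simpa using h.2
  | refill =>
    simp [BudgetBound, Op.apply] at h h2 ⊢
    omega
  | abort ht =>
    simp only [forall_const] at hz
    simp only [Op.apply, Function.update_eq_self]
    simp only [BudgetBound] at h ⊢
    -- Giving up requires an empty budget; after an exact simulation of `m` steps this would mean `b
    -- ≤ m + 1`, against `hP`.
    rcases h with h | ⟨-, m, hf, h⟩
    · exact ⟨h, by simp⟩
    · have := hF hf
      omega
  | @exec t ht =>
    obtain ⟨p, ⟨o, i⟩, p'⟩ := t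
    have hi : i < P.2.1 := by simpa using hl
    simp only [BudgetBound] at h
    have h2 := h2 (by simp)
    simp only at h2 hz
    have h0 : Function.update v (i + 3) (o.apply (v (i + 3))) 0 = v 0 :=
      Function.update_of_ne (by omega) _ _
    cases o with
    | inc =>
      simp only [Op.next, BudgetBound, Op.apply] at h h2 h0 ⊢
      rcases h with h | ⟨h, m, hf, h'⟩
      · left; omega
      · refine Or.inr ⟨by omega, m, hf.exec hi ht (by simp) (by simp), by omega⟩
    | dec =>
      simp only [Op.next, BudgetBound, Op.apply] at h h2 h0 ⊢
      rcases h with h | ⟨h, m, hf, h'⟩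
      · left; omega
      -- A truncated decrement followed by `store` creates the missing unit, and exactness is no
      -- longer needed.
      · by_cases hv : v (i + 3) = 0
        · left; omega
        · exact Or.inr ⟨by omega, m + 1, hf.exec hi ht (fun _ => hv) (by simp), by omega⟩
    | ifz =>
      simp only [Op.next, BudgetBound, Op.apply] at h h2 h0 ⊢
      rcases h with h | ⟨h, m, hf, h'⟩
      · left; omega
      · refine Or.inr ⟨by omega, m, hf.exec hi ht (by simp) (fun _ => hz rfl), by omega⟩
  | store ht =>
    simp only [BudgetBound, Op.apply] at h h2 ⊢
    have h2 := h2 (by norm_num)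
    rcases h with h | ⟨h, m, hf, h'⟩
    · left; omega
    · exact Or.inr ⟨by omega, m, hf.update (by norm_num) _, by simpa using h'⟩
  | pay ht | shift ht =>
    simp only [BudgetBound, Op.apply] at h h2 ⊢
    have h2 := h2 (by norm_num)
    rcases h with h | ⟨h, m, hf, h'⟩
    · left; omega
    -- By the bound on exact computations the budget is still positive, so paying is not truncated.
    · have := hF hf
      refine Or.inr ⟨by omega, m + 1, hf.update (by norm_num) _, ?_⟩
      rw [Function.update_self]
      omega
  | drain hj =>
    simp [BudgetBound, Op.apply] at h h2 ⊢
    omega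
  | @test j hj =>
    simp only [forall_const] at hz
    simp only [Op.apply, Function.update_eq_self]
    simp only [BudgetBound] at h ⊢
    refine ⟨h.1, fun i hi => ?_⟩
    rcases Nat.lt_succ_iff_lt_or_eq.1 hi with hi | rfl
    · exact h.2 i hi
    · exact hz
  | testEnd =>
    simp only [forall_const] at hz
    simp only [Op.apply, Function.update_eq_self]
    simp only [BudgetBound] at h ⊢
    have hc : Clean P.2.1 v := by
      intro i hi
      rcases Nat.lt_succ_iff_lt_or_eq.1 hi with hi | rfl
      · exact h.2 i hi
      · exact hz
    exact ⟨hc, by rw [← total_eq_of_clean hc]; exact h.1⟩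

end step

/-- If the machine has no computations of a certain length, then the automaton that simulates it
has no accepting run. -/
theorem Machine.not_lazyRun_descr {P : Machine} {n : ℕ} (hP : ∀ c, ¬ P.Reach n c)
    (τ : ℕ → Trans) : ¬ P.descr.LazyRun τ := by
  intro h
  choose s l s' hrule hτ using fun n => mem_descr_iff.1 (h.mem n)
  have hlink : ∀ n, s' n = s (n + 1) := by
    intro n
    have := h.link n
    rw [hτ, hτ] at this
    exact (Ctl.code_injective this).symm
  let v : ℕ → ℕ → ℕ := fun n i => val τ i n
  have hli : ∀ n, (τ n).2.2.1 = l n := fun n => by rw [hτ]; rfl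
  have hv : ∀ n, v (n + 1) = Function.update (v n) (l n).2 ((l n).1.apply (v n (l n).2)) := by
    intro n
    funext i
    by_cases hi : (l n).2 = i
    · subst hi
      rw [Function.update_self]
      exact val_succ_of_eq (hli n)
    · rw [Function.update_of_ne (Ne.symm hi)]
      exact val_succ_of_ne (by rw [hli]; exact hi)
  have hz : ∀ n, (l n).1 = .ifz → v n (l n).2 = 0 := by
    intro n hn
    have := h.zero n (by rw [hli]; exact hn)
    rw [hli] at this
    exact this
  have hl : ∀ n, (l n).2 < P.2.1 + 3 := fun n => by
    have := (h.inRange n).2.2.1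
    rw [hli] at this
    exact this
  have hrule' : ∀ n, Rule P (s n) (l n) (s (n + 1)) := fun n => hlink n ▸ hrule n
  have hfin : ∀ N, ∃ n, N < n ∧ s n = .fin := by
    intro N
    obtain ⟨n, hn, hf⟩ := h.final N
    refine ⟨n, hn, Ctl.code_injective ?_⟩
    rw [hτ] at hf
    exact List.mem_singleton.1 hf
  have h0 : s 0 = .fin := by
    have := h.start
    rw [hτ] at this
    exact Ctl.code_injective this
  have hA : ∀ b m n, m ≤ n → AllBound P.2.1 b (v m) (s m) → AllBound P.2.1 b (v n) (s n) := by
    intro b m n hmn hm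
    induction n, hmn using Nat.le_induction with
    | base => exact hm
    | succ n _ ih =>
      have := AllBound.step (hrule' n) (hl n) (hz n) ih
      rw [← hv] at this
      split_ifs at this
      · exact this.mono b.le_succ
      · exact this
  -- Every visit of `fin` adds a unit and there are infinitely many visits, so the stock of units
  -- exceeds any bound.
  have hB : ∀ b, ∃ n, s n = .fin ∧ AllBound P.2.1 b (v n) .fin := by
    intro b
    induction b with
    | zero => exact ⟨0, h0, fun _ _ => rfl, Nat.zero_le _⟩
    | succ b ih =>
      obtain ⟨m, hm, hb⟩ := ih
      have := AllBound.step (hrule' m) (hl m) (hz m) (hm ▸ hb)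
      rw [← hv, if_pos hm] at this
      obtain ⟨n, hn, hf⟩ := hfin m
      exact ⟨n, hf, hf ▸ hA _ _ _ hn this⟩
  obtain ⟨m, hm, hb⟩ := hB (n + 1)
  have hmove : s (m + 1) = .move := by
    have := hrule' m
    rw [hm] at this
    revert this
    generalize l m = x
    generalize s (m + 1) = y
    intro this
    cases this
    rfl
  have hP' : ∀ k c, P.Reach k c → k + 1 < n + 1 := by
    intro k c hk
    by_contra hlt
    obtain ⟨c', hc'⟩ := hk.of_le (m := n) (by omega)
    exact hP c' hc'
  -- From the `move` state after this visit on, `BudgetBound` persists; it is `False` at `fin`,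
  -- whereas `fin` must recur.
  have hG : ∀ k, m + 1 ≤ k → BudgetBound P (n + 1) (v k) (s k) := by
    intro k hk
    induction k, hk using Nat.le_induction with
    | base =>
      have := hA _ _ (m + 1) (Nat.le_succ m) (hm.symm ▸ hb)
      rw [hmove] at this ⊢
      refine ⟨this.1, ?_⟩
      have h' := this.2
      rw [total_eq_of_clean this.1] at h'
      exact h'
    | succ k _ ih =>
      rw [hv]
      exact BudgetBound.step (Nat.succ_pos n) hP' (hrule' k) (hl k) (hz k) ih
  obtain ⟨k, hk, hf⟩ := hfin m
  have := hG k hk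
  rw [hf] at this
  exact this

end ICA

/-! ### Infinite computations give accepting runs -/

namespace ICA

/-- A step with exact decrements of the automaton that simulates a machine. -/
def Machine.CStep (P : Machine) (c c' : Ctl × (ℕ → ℕ)) : Prop :=
  ∃ l, Rule P c.1 l c'.1 ∧ (l.1 = .ifz → c.2 l.2 = 0) ∧
    c'.2 = Function.update c.2 l.2 (l.1.apply (c.2 l.2))

/-- If from every point of a set one can return to the set, then there is an infinite path that
visits the set infinitely often. -/
theorem exists_recurrent_path {α : Type} {R : α → α → Prop} {X : Set α} {x : α} (hx : x ∈ X)
    (h : ∀ y ∈ X, ∃ z ∈ X, Relation.TransGen R y z) :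
    ∃ f : ℕ → α, f 0 = x ∧ (∀ n, R (f n) (f (n + 1))) ∧ ∀ N, ∃ n, N < n ∧ f n ∈ X := by
  -- `Dist n y` says that `X` can be reached from `y` in `n` steps. Carrying `n` along forces
  -- progress: it drops at each step, and a new one is chosen only on arrival in `X`.
  let Dist : ℕ → α → Prop := fun n y => Nat.rec (motive := fun _ => α → Prop) (fun y => y ∈ X)
    (fun _ D y => ∃ z, R y z ∧ D z) n y
  have dist_of : ∀ y z, Relation.ReflTransGen R y z → z ∈ X → ∃ n, Dist n y := by
    intro y z hyz hz
    induction hyz using Relation.ReflTransGen.head_induction_on with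
    | refl => exact ⟨0, hz⟩
    | head hab _ ih =>
      obtain ⟨n, hn⟩ := ih
      exact ⟨n + 1, _, hab, hn⟩
  have next : ∀ c : {c : ℕ × α // Dist c.1 c.2}, ∃ c' : {c : ℕ × α // Dist c.1 c.2},
      R c.1.2 c'.1.2 ∧ (c.1.1 ≠ 0 → c'.1.1 + 1 = c.1.1) := by
    rintro ⟨⟨n, y⟩, hc⟩
    cases n with
    | zero =>
      obtain ⟨z, hz, hyz⟩ := h y hc
      obtain ⟨w, hyw, hwz⟩ := Relation.TransGen.head'_iff.1 hyz
      obtain ⟨n, hn⟩ := dist_of _ _ hwz hz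
      exact ⟨⟨(n, w), hn⟩, hyw, fun h => absurd rfl h⟩
    | succ n =>
      obtain ⟨z, hyz, hz⟩ := hc
      exact ⟨⟨(n, z), hz⟩, hyz, fun _ => rfl⟩
  choose nx hR hnx using next
  let p : ℕ → {c : ℕ × α // Dist c.1 c.2} := fun n => nx^[n] ⟨(0, x), hx⟩
  have hps : ∀ n, p (n + 1) = nx (p n) := fun n => Function.iterate_succ_apply' _ _ _
  have hret : ∀ d n, (p n).1.1 = d → ∃ m, n ≤ m ∧ (p m).1.1 = 0 := by
    intro d
    induction d with
    | zero => exact fun n hn => ⟨n, le_rfl, hn⟩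
    | succ d ih =>
      intro n hn
      obtain ⟨m, hm, hm0⟩ := ih (n + 1) (by
        have := hnx (p n) (by omega)
        rw [← hps] at this
        omega)
      exact ⟨m, by omega, hm0⟩
  refine ⟨fun n => (p n).1.2, rfl, fun n => ?_, fun N => ?_⟩
  · have := hR (p n)
    rw [← hps] at this
    exact this
  · obtain ⟨m, hm, h0⟩ := hret _ (N + 1) rfl
    refine ⟨m, hm, ?_⟩
    have := (p m).2
    rw [h0] at this
    exact this

theorem Rule.bounds {P : Machine} (hP : P.WellFormed) {s s' : Ctl} {l : Op × ℕ}
    (h : Rule P s l s') : P.descr.InRange (ctlTrans s l s') := by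
  have hlab : ∀ a ∈ (ctlTrans s l s').2.1, a < 1 := by
    intro a ha
    obtain rfl := Option.some.inj ha
    exact one_pos
  show _ ≤ 6 * (P.1 + P.2.1) + 11 ∧ _ ∧ _ < P.2.1 + 3 ∧ _ ≤ 6 * (P.1 + P.2.1) + 11
  refine ⟨?_, hlab, ?_, ?_⟩
  all_goals simp only [ctlTrans]
  all_goals cases h with
  | abort h | store h | pay h | shift h =>
    have := hP _ h
    simp only [Ctl.code]
    omega
  | @exec t h =>
    have := hP _ h
    obtain ⟨p, ⟨o, i⟩, p'⟩ := t
    cases o <;> simp only [Op.next, Ctl.code] at this ⊢ <;> omega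
  | _ => simp only [Ctl.code]; omega

theorem Machine.exists_lazyRun_of_path {P : Machine} (hP : P.WellFormed)
    {f : ℕ → Ctl × (ℕ → ℕ)} (h0 : f 0 = (.fin, 0)) (hf : ∀ n, P.CStep (f n) (f (n + 1)))
    (hfin : ∀ N, ∃ n, N < n ∧ (f n).1 = .fin) : ∃ τ, P.descr.LazyRun τ := by
  choose l hrule hz hv using hf
  let τ : ℕ → Trans := fun n => ctlTrans (f n).1 (l n) (f (n + 1)).1
  have hval : ∀ n i, val τ i n = (f n).2 i := by
    intro n
    induction n with
    | zero => intro i; rw [h0]; rfl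
    | succ n ih =>
      intro i
      rw [hv]
      by_cases hi : (l n).2 = i
      · subst hi
        rw [Function.update_self, ← ih]
        exact val_succ_of_eq rfl
      · rw [Function.update_of_ne (Ne.symm hi), ← ih]
        exact val_succ_of_ne hi
  refine ⟨τ, fun n => mem_descr_iff.2 ⟨_, _, _, hrule n, rfl⟩, fun n => (hrule n).bounds hP, ?_,
    fun n => rfl, ?_, ?_, ?_⟩
  · show (f 0).1.code = 0
    rw [h0]; rfl
  · intro n hn
    rw [hval]
    exact hz n hn
  · intro N
    obtain ⟨n, hn, h⟩ := hfin N
    refine ⟨n, hn, List.mem_singleton.2 ?_⟩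
    show (f n).1.code = 0
    rw [h]; rfl
  · exact fun N => ⟨N + 1, N.lt_succ_self, by simp [τ, ctlTrans]⟩

/-- The values of the counters of the automaton that simulates a machine. -/
def counters (r y t : ℕ) (c : ℕ → ℕ) : ℕ → ℕ
  | 0 => r
  | 1 => y
  | 2 => t
  | i + 3 => c i

section path

variable {P : Machine} {r y t : ℕ} {c : ℕ → ℕ}

theorem update_counters_zero (x : ℕ) :
    Function.update (counters r y t c) 0 x = counters x y t c := by
  funext i
  rcases i with _ | _ | _ | i <;> simp [counters]

theorem update_counters_one (x : ℕ) :
    Function.update (counters r y t c) 1 x = counters r x t c := by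
  funext i
  rcases i with _ | _ | _ | i <;> simp [counters]

theorem update_counters_two (x : ℕ) :
    Function.update (counters r y t c) 2 x = counters r y x c := by
  funext i
  rcases i with _ | _ | _ | i <;> simp [counters]

theorem update_counters_add_three (i x : ℕ) :
    Function.update (counters r y t c) (i + 3) x = counters r y t (Function.update c i x) := by
  funext j
  rcases j with _ | _ | _ | j <;> simp [counters, Function.update_apply]

open Relation

theorem path_move (r y : ℕ) : ReflTransGen P.CStep (.move, counters r y 0 0)
    (.round, counters (r + y) 0 0 0) := by
  induction y generalizing r with
  | zero => exact .single ⟨_, .moveEnd, fun _ => rfl, (Function.update_eq_self _ _).symm⟩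
  | succ y ih =>
    refine .head (b := (.move', counters r y 0 0)) ⟨_, .moveDec, by simp,
      (update_counters_one y).symm⟩ (.head (b := (.move, counters (r + 1) y 0 0)) ⟨_, .moveInc,
        by simp, (update_counters_zero _).symm⟩ ?_)
    have := ih (r + 1)
    rwa [show r + 1 + y = r + (y + 1) by omega] at this

theorem path_test (r y : ℕ) (j : ℕ) (hj : j ≤ P.2.1) :
    ReflTransGen P.CStep (.test 0, counters r y 0 0) (.test j, counters r y 0 0) := by
  induction j with
  | zero => exact .refl
  | succ j ih =>
    refine (ih (by omega)).tail ⟨_, .test (by omega), fun _ => ?_, (Function.update_eq_self _ _).symm⟩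
    cases j <;> rfl

/-- The sum of the counters of a machine. -/
def counterSum (P : Machine) (c : ℕ → ℕ) : ℕ := ∑ i ∈ Finset.range P.2.1, c i

theorem counterSum_update {i : ℕ} (hi : i < P.2.1) (x : ℕ) :
    counterSum P (Function.update c i x) + c i = counterSum P c + x := by
  have hi' := Finset.mem_range.2 hi
  rw [counterSum, counterSum, Finset.sum_update_of_mem hi', Finset.sdiff_singleton_eq_erase,
    ← Finset.add_sum_erase _ c hi']
  omega

/-- Only counters of the machine are in use. -/
def Supported (P : Machine) (c : ℕ → ℕ) : Prop := ∀ i, P.2.1 ≤ i → c i = 0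

theorem Supported.update (h : Supported P c) {i : ℕ} (hi : i < P.2.1) (x : ℕ) :
    Supported P (Function.update c i x) := by
  intro j hj
  rw [Function.update_of_ne (by omega)]
  exact h j hj

/-- Each drained unit goes back to counter `0`, so the budget recovers everything that the
simulation had distributed. -/
theorem path_refill (n : ℕ) : ∀ (r y t : ℕ) (c : ℕ → ℕ), Supported P c → t + counterSum P c = n →
    ReflTransGen P.CStep (.test 0, counters r y t c) (.test 0, counters (r + n) y 0 0) := by
  induction n with
  | zero =>
    intro r y t c hc hn
    obtain rfl : t = 0 := by omega
    obtain rfl : c = 0 := by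
      funext i
      by_cases hi : i < P.2.1
      · have h0 : counterSum P c = 0 := by omega
        exact Finset.sum_eq_zero_iff.1 h0 i (Finset.mem_range.2 hi)
      · exact hc i (by omega)
    exact .refl
  | succ n ih =>
    intro r y t c hc hn
    rw [show r + (n + 1) = r + 1 + n by omega]
    rcases t with _ | t
    · obtain ⟨i, hi, hci⟩ : ∃ i < P.2.1, c i ≠ 0 := by
        by_contra! hall
        have : counterSum P c = 0 :=
          Finset.sum_eq_zero fun i hi => hall i (Finset.mem_range.1 hi)
        omega
      have hs := counterSum_update (c := c) hi (c i - 1)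
      refine .head (b := (.mid, counters r y 0 (Function.update c i (c i - 1))))
        ⟨_, .drain (j := i + 1) (by omega), by simp, (update_counters_add_three i _).symm⟩ (.head
        (b := (.test 0, counters (r + 1) y 0 (Function.update c i (c i - 1))))
          ⟨_, .refill, by simp, (update_counters_zero _).symm⟩ ?_)
      exact ih _ _ _ _ (hc.update hi _) (by omega)
    · refine .head (b := (.mid, counters r y t c)) ⟨_, .drain (j := 0) (by omega), by simp,
        (update_counters_two t).symm⟩ (.head (b := (.test 0, counters (r + 1) y t c))
          ⟨_, .refill, by simp, (update_counters_zero _).symm⟩ ?_)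
      exact ih _ _ _ _ hc (by omega)

/-- The measure `2 * r + counterSum` falls at every simulated instruction: by one at an increment,
which turns a unit of budget into a unit of the counter, by one at a decrement, and by two at a zero
test. So the budget runs out and `abort` applies; its source state has an instruction because the
computation `g` never stops. Units are conserved on the way. -/
theorem path_sim (hP : P.WellFormed) {g : ℕ → ℕ × (ℕ → ℕ)} (hg : ∀ n, P.Step (g n) (g (n + 1)))
    (y n : ℕ) : ∀ m r t, Supported P (g m).2 → 2 * r + counterSum P (g m).2 = n →
    ∃ t' c, Supported P c ∧ t' + counterSum P c = r + t + counterSum P (g m).2 ∧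
      ReflTransGen P.CStep (.sim (g m).1, counters r y t (g m).2) (.test 0, counters 0 y t' c) := by
  induction n using Nat.strong_induction_on with
  | _ n ih =>
    intro m r t hs hn
    obtain ⟨⟨o, i⟩, ht, hex⟩ := hg m
    have hi : i < P.2.1 := (hP _ ht).2.1
    rcases r with _ | r
    · exact ⟨t, _, hs, by omega,
        .single ⟨_, .abort ht, fun _ => rfl, (Function.update_eq_self _ _).symm⟩⟩
    have hup := hex.eq_update
    have hsum := counterSum_update (c := (g m).2) hi (o.apply ((g m).2 i))
    have hs' := hs.update hi (o.apply ((g m).2 i))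
    simp only at hup
    rw [← hup] at hsum hs'
    have hstep : (o = .ifz → (g m).2 i = 0) → P.CStep (.sim (g m).1, counters (r + 1) y t (g m).2)
        (o.next (g (m + 1)).1, counters (r + 1) y t (g (m + 1)).2) := by
      intro hz
      refine ⟨_, .exec ht, hz, ?_⟩
      rw [hup]
      exact (update_counters_add_three i _).symm
    have hval := hex.2
    cases o with
    | inc =>
      simp only [Op.apply] at hsum
      obtain ⟨t', c, hc, hc', hpath⟩ := ih _ (by omega) (m + 1) r t hs' rfl
      refine ⟨t', c, hc, by omega, .head (hstep (by simp)) (.head ?_ hpath)⟩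
      exact ⟨_, .pay ht, by simp, (update_counters_zero r).symm⟩
    | dec =>
      simp only [Op.apply] at hsum hval
      obtain ⟨t', c, hc, hc', hpath⟩ := ih _ (by omega) (m + 1) (r + 1) (t + 1) hs' rfl
      refine ⟨t', c, hc, by omega, .head (hstep (by simp)) (.head ?_ hpath)⟩
      exact ⟨_, .store ht, by simp, (update_counters_two (t + 1)).symm⟩
    | ifz =>
      simp only [Op.apply] at hsum hval
      obtain ⟨t', c, hc, hc', hpath⟩ := ih _ (by omega) (m + 1) r (t + 1) hs' rfl
      refine ⟨t', c, hc, by omega, .head (hstep fun _ => hval.1) (.head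
        (b := (.store (g (m + 1)).1, counters r y t (g (m + 1)).2)) ?_ (.head ?_ hpath))⟩
      · exact ⟨_, .shift ht, by simp, (update_counters_zero r).symm⟩
      · exact ⟨_, .store ht, by simp, (update_counters_two (t + 1)).symm⟩

/-- An exact simulation returns its whole budget, so each round costs only the unit saved in counter
`1`, and the rounds end with all units there. -/
theorem path_round (hP : P.WellFormed) {g : ℕ → ℕ × (ℕ → ℕ)} (h0 : g 0 = (0, 0))
    (hg : ∀ n, P.Step (g n) (g (n + 1))) (r y : ℕ) :
    ReflTransGen P.CStep (.round, counters r y 0 0) (.fin, counters 0 (y + r) 0 0) := by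
  induction r generalizing y with
  | zero => exact .single ⟨_, .roundEnd, fun _ => rfl, (Function.update_eq_self _ _).symm⟩
  | succ r ih =>
    have hsum : counterSum P (g 0).2 = 0 := by rw [h0]; exact Finset.sum_const_zero
    obtain ⟨t', c, hc, hc', hpath⟩ := path_sim hP hg (y + 1) _ 0 r 0
      (by rw [h0]; exact fun _ _ => rfl) rfl
    rw [hsum] at hc'
    rw [h0] at hpath
    refine .head (b := (.round', counters r y 0 0)) ⟨_, .roundDec, by simp,
      (update_counters_zero r).symm⟩ (.head (b := (.sim 0, counters r (y + 1) 0 0)) ⟨_, .roundInc,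
        by simp, (update_counters_one _).symm⟩ (hpath.trans ?_))
    have h1 := path_refill (P := P) r 0 (y + 1) t' c hc (by omega)
    have h2 := path_test (P := P) (0 + r) (y + 1) _ le_rfl
    refine h1.trans (h2.trans (.head (b := (.round, counters r (y + 1) 0 0))
      ⟨_, .testEnd, fun _ => ?_, ?_⟩ ?_))
    · show counters _ _ _ _ (P.2.1 + 2) = 0
      cases P.2.1 <;> rfl
    · rw [zero_add]; exact (Function.update_eq_self _ _).symm
    · rw [show y + (r + 1) = y + 1 + r by omega]
      exact ih (y + 1)

end path

/-- If the machine has an infinite computation, then the automaton that simulates it has an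
accepting run. -/
theorem Machine.exists_lazyRun_descr {P : Machine} (hP : P.WellFormed) {g : ℕ → ℕ × (ℕ → ℕ)}
    (h0 : g 0 = (0, 0)) (hg : ∀ n, P.Step (g n) (g (n + 1))) : ∃ τ, P.descr.LazyRun τ := by
  obtain ⟨f, hf0, hf, hfin⟩ := exists_recurrent_path (R := P.CStep) (x := (.fin, 0))
    (X := {c | ∃ y, c = (.fin, counters 0 y 0 0)})
    ⟨0, Prod.ext rfl (by funext i; rcases i with _ | _ | _ | i <;> rfl)⟩ (by
      rintro _ ⟨y, rfl⟩
      refine ⟨_, ⟨0 + (1 + y), rfl⟩, Relation.TransGen.head' (b := (.move, counters 1 y 0 0))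
        ⟨_, .fin, by simp, (update_counters_zero 1).symm⟩
        ((path_move 1 y).trans (path_round hP h0 hg (1 + y) 0))⟩)
  refine P.exists_lazyRun_of_path hP hf0 hf fun N => ?_
  obtain ⟨n, hn, y, hy⟩ := hfin N
  exact ⟨n, hn, by rw [hy]⟩

end ICA

namespace ICA

/-! Computability of the automaton that simulates a machine. -/

section

variable {γ : Type} [Primcodable γ]

theorem primrec_trans {q q' : γ → ℕ} {l : γ → Op × ℕ} (hq : Primrec q) (hl : Primrec l)
    (hq' : Primrec q') : Primrec fun c => ((q c, some 0, l c, q' c) : Trans) :=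
  hq.pair ((Primrec.const (some 0)).pair (hl.pair hq'))

theorem primrec_instr (o : Op) {i : γ → ℕ} (hi : Primrec i) : Primrec fun c => (o, i c) :=
  (Primrec.const o).pair hi

theorem primrec_affine (a b : ℕ) {f : γ → ℕ} (hf : Primrec f) : Primrec fun c => a * f c + b :=
  Primrec.nat_add.comp (Primrec.nat_mul.comp (Primrec.const a) hf) (Primrec.const b)

end

theorem primrec_instrTrans : Primrec instrTrans := by
  have h1 : Primrec fun t : ℕ × (Op × ℕ) × ℕ => t.1 := Primrec.fst
  have h2 : Primrec fun t : ℕ × (Op × ℕ) × ℕ => t.2.1.1 :=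
    Primrec.fst.comp (Primrec.fst.comp Primrec.snd)
  have h3 : Primrec fun t : ℕ × (Op × ℕ) × ℕ => t.2.1.2 :=
    Primrec.snd.comp (Primrec.fst.comp Primrec.snd)
  have h4 : Primrec fun t : ℕ × (Op × ℕ) × ℕ => t.2.2 := Primrec.snd.comp Primrec.snd
  have hnext : Primrec fun t : ℕ × (Op × ℕ) × ℕ => (t.2.1.1.next t.2.2).code := by
    have : Finite Op := Finite.of_equiv _ Op.equivFin.symm
    have ho : Primrec fun o : Op => (o.next 0).code := Primrec.dom_finite _
    refine (Primrec.nat_add.comp (primrec_affine 6 0 h4) (ho.comp h2)).of_eq fun t => ?_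
    cases t.2.1.1 <;> rfl
  exact Primrec.list_cons.comp
      (primrec_trans (primrec_affine 6 7 h1) (Primrec.const _) (Primrec.const _)) <|
    Primrec.list_cons.comp
      (primrec_trans (primrec_affine 6 7 h1)
        (h2.pair (Primrec.nat_add.comp h3 (Primrec.const 3))) hnext) <|
    Primrec.list_cons.comp
      (primrec_trans (primrec_affine 6 8 h4) (Primrec.const _) (primrec_affine 6 7 h4)) <|
    Primrec.list_cons.comp
      (primrec_trans (primrec_affine 6 9 h4) (Primrec.const _) (primrec_affine 6 7 h4)) <|
    Primrec.list_cons.comp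
      (primrec_trans (primrec_affine 6 10 h4) (Primrec.const _) (primrec_affine 6 8 h4)) <|
    Primrec.const []

theorem primrec_descr : Primrec Machine.descr := by
  have hN : Primrec fun P : Machine => P.1 := Primrec.fst
  have hk : Primrec fun P : Machine => P.2.1 := Primrec.fst.comp Primrec.snd
  have hL : Primrec fun P : Machine => P.2.2 := Primrec.snd.comp Primrec.snd
  have hadd : ∀ (n : ℕ) {γ : Type} [Primcodable γ] {f : γ → ℕ}, Primrec f →
      Primrec fun c => f c + n := fun n _ _ _ hf => Primrec.nat_add.comp hf (Primrec.const n)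
  have hdrain : Primrec₂ fun (_ : Machine) (j : ℕ) => ctlTrans (.test 0) (.dec, j + 2) .mid :=
    Primrec₂.mk (primrec_trans (Primrec.const _) (primrec_instr _ (hadd 2 Primrec.snd))
      (Primrec.const _))
  have htest : Primrec₂ fun (_ : Machine) (j : ℕ) =>
      ctlTrans (.test j) (.ifz, j + 2) (.test (j + 1)) :=
    Primrec₂.mk (primrec_trans (primrec_affine 6 5 Primrec.snd)
      (primrec_instr _ (hadd 2 Primrec.snd)) (primrec_affine 6 5 (hadd 1 Primrec.snd)))
  have hend : Primrec fun P : Machine => ctlTrans (.test P.2.1) (.ifz, P.2.1 + 2) .round :=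
    primrec_trans (primrec_affine 6 5 hk) (primrec_instr _ (hadd 2 hk)) (Primrec.const _)
  exact (primrec_affine 6 11 (Primrec.nat_add.comp hN hk)).pair ((Primrec.const 1).pair
    ((hadd 3 hk).pair (Primrec.pair (Primrec.list_cons.comp hend
      (Primrec.list_append.comp (Primrec.const commonTrans) (Primrec.list_append.comp
        (Primrec.list_flatMap hL (primrec_instrTrans.comp Primrec.snd).to₂)
        (Primrec.list_append.comp
          (Primrec.list_map (Primrec.list_range.comp (hadd 1 hk)) hdrain)
          (Primrec.list_map (Primrec.list_range.comp hk) htest))))) (Primrec.const [0]))))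

end ICA

namespace ICA

/-! A programming language with registers. -/

/-- Programs: `loop i c` repeats decrementing register `i` and running `c` until the register is
`0`. -/
inductive Cmd
  | skip
  | inc (i : ℕ)
  | seq (a b : Cmd)
  | loop (i : ℕ) (c : Cmd)
deriving Encodable

namespace Cmd

open Function

/-- One step of the execution of a list of programs. -/
def step : List Cmd × (ℕ → ℕ) → List Cmd × (ℕ → ℕ)
  | ([], σ) => ([], σ)
  | (skip :: k, σ) => (k, σ)
  | (inc i :: k, σ) => (k, update σ i (σ i + 1))
  | (seq a b :: k, σ) => (a :: b :: k, σ)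
  | (loop i c :: k, σ) => if σ i = 0 then (k, σ) else (c :: loop i c :: k, update σ i (σ i - 1))

/-- The second configuration is reached from the first. -/
def Leads (x y : List Cmd × (ℕ → ℕ)) : Prop := ∃ m, step^[m] x = y

theorem Leads.trans {x y z : List Cmd × (ℕ → ℕ)} (h : Leads x y) (h' : Leads y z) : Leads x z := by
  obtain ⟨m, rfl⟩ := h
  obtain ⟨n, rfl⟩ := h'
  exact ⟨n + m, Function.iterate_add_apply _ _ _ _⟩

theorem Leads.head {x y : List Cmd × (ℕ → ℕ)} (h : Leads (step x) y) : Leads x y :=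
  Leads.trans ⟨1, rfl⟩ h

/-- The program terminates and has the given effect. -/
def Runs (c : Cmd) (σ τ : ℕ → ℕ) : Prop := ∀ k, Leads (c :: k, σ) (k, τ)

theorem runs_skip (σ : ℕ → ℕ) : Runs skip σ σ := fun _ => ⟨1, rfl⟩

theorem runs_inc (i : ℕ) (σ : ℕ → ℕ) : Runs (inc i) σ (update σ i (σ i + 1)) := fun _ => ⟨1, rfl⟩

theorem Runs.seq {a b : Cmd} {σ τ ρ : ℕ → ℕ} (h : Runs a σ τ) (h' : Runs b τ ρ) :
    Runs (seq a b) σ ρ := fun k => Leads.head ((h (b :: k)).trans (h' k))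

theorem leads_loop {i : ℕ} {c : Cmd} {σ τ : ℕ → ℕ} (h0 : σ i ≠ 0)
    (h : Runs c (update σ i (σ i - 1)) τ) (k : List Cmd) :
    Leads (loop i c :: k, σ) (loop i c :: k, τ) := by
  refine Leads.head ?_
  rw [step, if_neg h0]
  exact h _

/-- `S m` is the state at the test before iteration `m`. The body may rewrite register `i`, so the
number `N` of iterations is not determined by the initial value and unbounded search is available.
-/
theorem Runs.loop {i : ℕ} {c : Cmd} (S : ℕ → ℕ → ℕ) (N : ℕ) (h0 : ∀ m < N, S m i ≠ 0)
    (h : ∀ m < N, Runs c (update (S m) i (S m i - 1)) (S (m + 1))) (hN : S N i = 0) :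
    Runs (loop i c) (S 0) (S N) := by
  intro k
  have key : ∀ m ≤ N, Leads (Cmd.loop i c :: k, S 0) (Cmd.loop i c :: k, S m) := by
    intro m
    induction m with
    | zero => exact fun _ => ⟨0, rfl⟩
    | succ m ih => exact fun hm => (ih (by omega)).trans (leads_loop (h0 m hm) (h m hm) k)
  refine (key N le_rfl).trans (Leads.head ?_)
  rw [step, if_pos hN]
  exact ⟨0, rfl⟩

theorem Runs.of_eq {c : Cmd} {σ τ ρ : ℕ → ℕ} (h : Runs c σ τ) (h' : τ = ρ) : Runs c σ ρ := h' ▸ h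

/-- Set a register to `0`. -/
def clear (i : ℕ) : Cmd := loop i skip

theorem runs_clear (i : ℕ) (σ : ℕ → ℕ) : Runs (clear i) σ (update σ i 0) := by
  have := Runs.loop (i := i) (c := skip) (fun m => update σ i (σ i - m)) (σ i)
    (fun m hm => by simp; omega)
    (fun m hm => (runs_skip _).of_eq (by simp; congr 1)) (by simp)
  simpa [clear] using this

/-- Move the content of a register. -/
def move (a b : ℕ) : Cmd := seq (clear b) (loop a (inc b))

theorem runs_move {a b : ℕ} (hab : a ≠ b) (σ : ℕ → ℕ) :
    Runs (move a b) σ (update (update σ b (σ a)) a 0) := by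
  have := Runs.loop (i := a) (c := inc b) (fun m => update (update σ b m) a (σ a - m)) (σ a)
    (fun m hm => by simp; omega)
    (fun m hm => (runs_inc _ _).of_eq (by
      funext j
      simp only [update_apply]
      split_ifs <;> omega)) (by simp)
  refine (runs_clear b σ).seq ?_
  simp only [Nat.sub_zero, Nat.sub_self] at this
  rw [show update σ b 0 = update (update σ b 0) a (σ a) from ?_]
  · exact this
  · funext j
    simp only [update_apply]
    split_ifs <;> simp_all

/-- Copy the content of a register with the help of a third register. -/
def copy (a b t : ℕ) : Cmd :=
  seq (clear b) (seq (loop a (seq (inc b) (inc t))) (loop t (inc a)))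

theorem runs_copy {a b t : ℕ} (hab : a ≠ b) (hat : a ≠ t) (hbt : b ≠ t) {σ : ℕ → ℕ}
    (ht : σ t = 0) : Runs (copy a b t) σ (update σ b (σ a)) := by
  have h1 := Runs.loop (i := a) (c := seq (inc b) (inc t))
    (fun m => update (update (update σ b m) a (σ a - m)) t m) (σ a)
    (fun m hm => by simp [hat]; omega)
    (fun m hm => ((runs_inc _ _).seq (runs_inc _ _)).of_eq (by
      funext j
      simp only [update_apply]
      split_ifs <;> omega)) (by simp [hat])
  have h2 := Runs.loop (i := t) (c := inc a)
    (fun m => update (update (update σ b (σ a)) a m) t (σ a - m)) (σ a)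
    (fun m hm => by simp; omega)
    (fun m hm => (runs_inc _ _).of_eq (by
      funext j
      simp only [update_apply]
      split_ifs <;> omega)) (by simp)
  simp only [Nat.sub_zero, Nat.sub_self] at h1 h2
  refine (runs_clear b σ).seq ?_
  rw [show update σ b 0 = update (update (update σ b 0) a (σ a)) t 0 from ?_]
  · refine (h1.seq h2).of_eq ?_
    funext j
    simp only [update_apply]
    split_ifs <;> simp_all
  · funext j
    simp only [update_apply]
    split_ifs <;> simp_all

/-- All functions of the form `f` can be computed, with any choice of the registers for the
arguments and the value and with arbitrary scratch registers from `base` on. -/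
def Computes {n : ℕ} (f : List.Vector ℕ n → ℕ) : Prop :=
  ∀ (ins : Fin n → ℕ) (out base : ℕ), (∀ i, ins i < base) → out < base →
    ∃ c, ∀ σ : ℕ → ℕ, (∀ j, base ≤ j → σ j = 0) →
      Runs c σ (update σ out (f (List.Vector.ofFn fun i => σ (ins i))))

theorem exists_clear_range (base m : ℕ) :
    ∃ c, ∀ σ : ℕ → ℕ, Runs c σ (fun j => if base ≤ j ∧ j < base + m then 0 else σ j) := by
  induction m with
  | zero =>
    refine ⟨skip, fun σ => (runs_skip σ).of_eq ?_⟩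
    funext j
    rw [if_neg (by omega)]
  | succ m ih =>
    obtain ⟨c, hc⟩ := ih
    refine ⟨c.seq (clear (base + m)), fun σ => ((hc σ).seq (runs_clear _ _)).of_eq ?_⟩
    funext j
    simp only [update_apply]
    split_ifs <;> omega

/-- The value passes through the scratch register `base`, since `out` may coincide with the argument
register and `copy` needs distinct registers. -/
theorem computes_get {n : ℕ} (i : Fin n) : Computes fun v => v.get i := by
  intro ins out base hins hout
  have := hins i
  refine ⟨seq (copy (ins i) base (base + 1)) (move base out), fun σ hσ =>
    ((runs_copy (by omega) (by omega) (by omega) (hσ _ (by omega))).seq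
      (runs_move (by omega) _)).of_eq ?_⟩
  have h0 := hσ base le_rfl
  funext j
  simp only [update_apply, List.Vector.get_ofFn]
  split_ifs <;> first | rfl | omega | simp_all

theorem computes_succ : Computes fun v : List.Vector ℕ 1 => v.head.succ := by
  intro ins out base hins hout
  have := hins 0
  refine ⟨seq (copy (ins 0) base (base + 1)) (seq (inc base) (move base out)), fun σ hσ =>
    ((runs_copy (by omega) (by omega) (by omega) (hσ _ (by omega))).seq
      ((runs_inc _ _).seq (runs_move (by omega) _))).of_eq ?_⟩
  have h0 := hσ base le_rfl
  have hh : (List.Vector.ofFn fun i => σ (ins i)).head = σ (ins 0) := rfl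
  funext j
  simp only [update_apply, hh]
  split_ifs <;> first | rfl | omega | simp_all

/-- The intermediate values are kept in `base, …, base + n - 1`, above all arguments, and the
scratch area of the subprograms starts at `base + n`. The final clearing restores the zeros required
of scratch registers. -/
theorem computes_comp {m n : ℕ} {f : List.Vector ℕ n → ℕ} {g : Fin n → List.Vector ℕ m → ℕ}
    (hf : Computes f) (hg : ∀ i, Computes (g i)) :
    Computes fun a => f (List.Vector.ofFn fun i => g i a) := by
  intro ins out base hins hout
  let G : ℕ → List.Vector ℕ m → ℕ := fun i a => if h : i < n then g ⟨i, h⟩ a else 0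
  have hargs : ∀ k ≤ n, ∃ c, ∀ σ : ℕ → ℕ, (∀ j, base ≤ j → σ j = 0) → Runs c σ (fun j =>
      if base ≤ j ∧ j < base + k then G (j - base) (List.Vector.ofFn fun i => σ (ins i))
      else σ j) := by
    intro k
    induction k with
    | zero =>
      refine fun _ => ⟨skip, fun σ _ => (runs_skip σ).of_eq ?_⟩
      funext j
      rw [if_neg (by omega)]
    | succ k ih =>
      intro hk
      obtain ⟨c, hc⟩ := ih (by omega)
      obtain ⟨c', hc'⟩ := hg ⟨k, hk⟩ ins (base + k) (base + n)
        (fun i => (hins i).trans_le (by omega)) (by omega)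
      refine ⟨c.seq c', fun σ hσ => ((hc σ hσ).seq (hc' _ ?_)).of_eq ?_⟩
      · intro j hj
        rw [if_neg (by omega)]
        exact hσ j (by omega)
      · have hv : ∀ i, (if base ≤ ins i ∧ ins i < base + k then
            G (ins i - base) (List.Vector.ofFn fun i => σ (ins i)) else σ (ins i)) = σ (ins i) := by
          intro i
          have := hins i
          rw [if_neg (by omega)]
        simp only [hv]
        funext j
        simp only [update_apply]
        by_cases hj : j = base + k
        · subst hj
          rw [if_pos rfl, if_pos (by omega), Nat.add_sub_cancel_left]
          simp only [G, dif_pos (show k < n from hk)]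
        · rw [if_neg hj]
          split_ifs <;> first | rfl | omega
  obtain ⟨c1, h1⟩ := hargs n le_rfl
  obtain ⟨c2, h2⟩ := hf (fun i => base + i) out (base + n) (fun i => by omega) (by omega)
  obtain ⟨c3, h3⟩ := exists_clear_range base n
  refine ⟨c1.seq (c2.seq c3), fun σ hσ => ((h1 σ hσ).seq ((h2 _ ?_).seq (h3 _))).of_eq ?_⟩
  · intro j hj
    rw [if_neg (by omega)]
    exact hσ j (by omega)
  · have hv : (List.Vector.ofFn fun i : Fin n => if base ≤ base + i.val ∧ base + i.val < base + n then
        G (base + i - base) (List.Vector.ofFn fun i => σ (ins i)) else σ (base + i)) =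
        List.Vector.ofFn fun i => g i (List.Vector.ofFn fun i => σ (ins i)) := by
      congr 1
      funext i
      rw [if_pos (by omega), Nat.add_sub_cancel_left]
      simp [G]
    rw [hv]
    funext j
    simp only [update_apply]
    by_cases hj : base ≤ j ∧ j < base + n
    · rw [if_pos hj, if_neg (by omega), hσ j hj.1]
    · rw [if_neg hj, if_neg hj]

theorem computes_prec {n : ℕ} {f : List.Vector ℕ n → ℕ} {g : List.Vector ℕ (n + 2) → ℕ}
    (hf : Computes f) (hg : Computes g) : Computes fun v : List.Vector ℕ (n + 1) =>
      v.head.rec (f v.tail) fun y IH => g (y ::ᵥ IH ::ᵥ v.tail) := by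
  intro ins out base hins hout
  obtain ⟨c1, h1⟩ := hf (fun i => ins i.succ) (base + 1) (base + 4)
    (fun i => (hins _).trans_le (by omega)) (by omega)
  obtain ⟨c2, h2⟩ := hg (Fin.cons base (Fin.cons (base + 1) fun i => ins i.succ)) (base + 3)
    (base + 4) (fun i => by
      refine Fin.cases ?_ (fun i => Fin.cases ?_ (fun i => ?_) i) i
      · simp
      · simp
      · have := hins i.succ
        simp only [Fin.cons_succ]
        omega) (by omega)
  refine ⟨c1.seq ((copy (ins 0) (base + 2) (base + 4)).seq ((loop (base + 2) (c2.seq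
    ((move (base + 3) (base + 1)).seq (inc base)))).seq ((move (base + 1) out).seq (clear base)))),
    fun σ hσ => ?_⟩
  set w : List.Vector ℕ n := List.Vector.ofFn fun i => σ (ins i.succ) with hw
  have hi0 := hins 0
  let R : ℕ → ℕ := fun m => m.rec (f w) fun y IH => g (y ::ᵥ IH ::ᵥ w)
  -- Register `base` counts iterations, `base + 1` holds the current value and `base + 2` the
  -- iterations left. The next value is prepared in `base + 3`, so that the arguments survive its
  -- computation.
  let S : ℕ → ℕ → ℕ := fun m =>
    update (update (update σ base m) (base + 1) (R m)) (base + 2) (σ (ins 0) - m)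
  have s1 := h1 σ (fun j hj => hσ j (by omega))
  have s2 := runs_copy (a := ins 0) (b := base + 2) (t := base + 4) (by omega) (by omega)
    (by omega) (σ := update σ (base + 1) (f w)) (by
      rw [update_of_ne (by omega)]; exact hσ _ (by omega))
  have e2 : update (update σ (base + 1) (f w)) (base + 2) (update σ (base + 1) (f w) (ins 0)) =
      S 0 := by
    have := hσ base le_rfl
    funext j
    simp only [S, update_apply]
    split_ifs <;> first | rfl | omega | simp_all
  rw [e2] at s2
  have s3 : Runs (loop (base + 2) (c2.seq ((move (base + 3) (base + 1)).seq (inc base)))) (S 0)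
      (S (σ (ins 0))) := by
    refine Runs.loop S _ (fun m hm => by simp [S]; omega) (fun m hm => ?_) (by simp [S])
    refine ((h2 _ fun j hj => ?_).seq ((runs_move (by omega) _).seq (runs_inc _ _))).of_eq ?_
    · simp only [S, update_apply]
      rw [if_neg (by omega), if_neg (by omega), if_neg (by omega), if_neg (by omega)]
      exact hσ j (by omega)
    · have hv : (List.Vector.ofFn fun i : Fin (n + 2) => update (S m) (base + 2)
          (S m (base + 2) - 1) ((Fin.cons base (Fin.cons (base + 1) fun i => ins i.succ) :
            Fin (n + 2) → ℕ) i)) = m ::ᵥ R m ::ᵥ w := by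
        rw [List.Vector.ofFn, List.Vector.ofFn]
        congr 1
        · simp [S]
        · congr 1
          · simp [S]
          · rw [hw]
            congr 1
            funext i
            have := hins i.succ
            simp only [Fin.cons_succ, S, update_apply]
            rw [if_neg (by omega), if_neg (by omega), if_neg (by omega), if_neg (by omega)]
      rw [hv]
      have hR : R (m + 1) = g (m ::ᵥ R m ::ᵥ w) := rfl
      have h3 := hσ (base + 3) (by omega)
      rw [← hR]
      funext j
      simp only [S, update_apply]
      split_ifs <;> first | rfl | omega | simp_all
  refine (s1.seq (s2.seq (s3.seq ((runs_move (by omega) _).seq (runs_clear _ _))))).of_eq ?_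
  change _ = update σ out (R (σ (ins 0)))
  have h0 := hσ base le_rfl
  have h1 := hσ (base + 1) (by omega)
  have h2 := hσ (base + 2) (by omega)
  funext j
  simp only [S, update_apply]
  split_ifs <;> first | rfl | omega | simp_all

theorem computes_of_primrec {n : ℕ} {f : List.Vector ℕ n → ℕ} (hf : Nat.Primrec' f) :
    Computes f := by
  induction hf with
  | zero => exact fun _ out _ _ _ => ⟨clear out, fun σ _ => runs_clear out σ⟩
  | succ => exact computes_succ
  | get i => exact computes_get i
  | comp g _ _ hf hg => exact computes_comp hf hg
  | prec _ _ hf hg => exact computes_prec hf hg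

end Cmd

end ICA

/-! ### Counter machines that execute programs -/

namespace ICA

open Function Cmd

/-- The instructions of the machine that executes lists of programs. Counter `0` is always `0`, and
counter `i + 1` contains register `i`. -/
inductive CmdRule : List Cmd → Op × ℕ → List Cmd → Prop
  | skip (k : List Cmd) : CmdRule (.skip :: k) (.ifz, 0) k
  | inc (i : ℕ) (k : List Cmd) : CmdRule (.inc i :: k) (.inc, i + 1) k
  | seq (a b : Cmd) (k : List Cmd) : CmdRule (.seq a b :: k) (.ifz, 0) (a :: b :: k)
  | exit (i : ℕ) (c : Cmd) (k : List Cmd) : CmdRule (.loop i c :: k) (.ifz, i + 1) k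
  | enter (i : ℕ) (c : Cmd) (k : List Cmd) :
      CmdRule (.loop i c :: k) (.dec, i + 1) (c :: .loop i c :: k)

/-- The instructions that are needed to execute a program before a list of programs. -/
def Cmd.instrs : Cmd → List Cmd → List (List Cmd × (Op × ℕ) × List Cmd)
  | skip, k => [(skip :: k, (.ifz, 0), k)]
  | inc i, k => [(inc i :: k, (.inc, i + 1), k)]
  | seq a b, k => (seq a b :: k, (.ifz, 0), a :: b :: k) :: (a.instrs (b :: k) ++ b.instrs k)
  | loop i c, k => (loop i c :: k, (.ifz, i + 1), k) ::
      (loop i c :: k, (.dec, i + 1), c :: loop i c :: k) :: c.instrs (loop i c :: k)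

theorem Cmd.cmdRule_of_mem_instrs {c : Cmd} {k : List Cmd}
    {t : List Cmd × (Op × ℕ) × List Cmd} (h : t ∈ c.instrs k) : CmdRule t.1 t.2.1 t.2.2 := by
  induction c generalizing k with
  | skip => obtain rfl := List.mem_singleton.1 h; exact .skip k
  | inc i => obtain rfl := List.mem_singleton.1 h; exact .inc i k
  | seq a b iha ihb =>
    simp only [Cmd.instrs, List.mem_cons, List.mem_append] at h
    rcases h with rfl | h | h
    exacts [.seq a b k, iha h, ihb h]
  | loop i c ih =>
    simp only [Cmd.instrs, List.mem_cons] at h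
    rcases h with rfl | rfl | h
    exacts [.exit i c k, .enter i c k, ih h]

/-- The list contains all instructions that are needed to execute a list of programs. -/
inductive Covered (L : List (List Cmd × (Op × ℕ) × List Cmd)) : List Cmd → Prop
  | nil : Covered L []
  | cons {c : Cmd} {k : List Cmd} (h : c.instrs k ⊆ L) (hk : Covered L k) : Covered L (c :: k)

/-- The counters of the machine for given registers. -/
def lift (σ : ℕ → ℕ) : ℕ → ℕ
  | 0 => 0
  | i + 1 => σ i

theorem lift_update (σ : ℕ → ℕ) (i x : ℕ) : lift (update σ i x) = update (lift σ) (i + 1) x := by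
  funext j
  cases j <;> simp [lift, update_apply]

/-- The lists of programs that arise as continuations all come from the text of the initial program,
so finitely many instructions serve the whole execution. -/
theorem Covered.step {L : List (List Cmd × (Op × ℕ) × List Cmd)} {x : List Cmd × (ℕ → ℕ)}
    (h : Covered L x.1) : Covered L (Cmd.step x).1 := by
  obtain ⟨k, σ⟩ := x
  cases h with
  | nil => exact .nil
  | @cons c k hc hk =>
    cases c with
    | skip => exact hk
    | inc i => exact hk
    | seq a b =>
      rw [Cmd.instrs, List.cons_subset, List.append_subset] at hc
      exact .cons hc.2.1 (.cons hc.2.2 hk)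
    | loop i c =>
      have hc' := hc
      rw [Cmd.instrs, List.cons_subset, List.cons_subset] at hc'
      simp only [Cmd.step]
      split_ifs
      · exact hk
      · exact .cons hc'.2.2 (.cons hc hk)

theorem Covered.exists_exec {L : List (List Cmd × (Op × ℕ) × List Cmd)} {x : List Cmd × (ℕ → ℕ)}
    (h : Covered L x.1) (hx : x.1 ≠ []) :
    ∃ l, (x.1, l, (Cmd.step x).1) ∈ L ∧ Exec l (lift x.2) (lift (Cmd.step x).2) := by
  obtain ⟨k, σ⟩ := x
  have key : ∀ {l : Op × ℕ} {τ : ℕ → ℕ}, lift τ = update (lift σ) l.2 (l.1.apply (lift σ l.2)) →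
      (l.1 = .dec → lift σ l.2 ≠ 0) → (l.1 = .ifz → lift σ l.2 = 0) →
      Exec l (lift σ) (lift τ) := fun h hd hz => h ▸ exec_update hd hz
  cases h with
  | nil => exact absurd rfl hx
  | @cons c k hc hk =>
    cases c with
    | skip => exact ⟨_, hc List.mem_cons_self, key (update_eq_self _ _).symm (by simp) fun _ => rfl⟩
    | inc i => exact ⟨_, hc List.mem_cons_self, key (lift_update _ _ _) (by simp) (by simp)⟩
    | seq a b =>
      exact ⟨_, hc List.mem_cons_self, key (update_eq_self _ _).symm (by simp) fun _ => rfl⟩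
    | loop i c =>
      rw [Cmd.instrs, List.cons_subset, List.cons_subset] at hc
      by_cases h0 : σ i = 0
      · simp only [Cmd.step, if_pos h0]
        exact ⟨_, hc.1, key (update_eq_self _ _).symm (by simp) fun _ => h0⟩
      · simp only [Cmd.step, if_neg h0]
        exact ⟨_, hc.2.1, key (lift_update _ _ _) (fun _ => h0) (by simp)⟩

/-- The machine is deterministic: of the two instructions for a loop only the one agreeing with the
register can be executed. -/
theorem CmdRule.eq_step {k k' : List Cmd} {l : Op × ℕ} {σ v : ℕ → ℕ} (h : CmdRule k l k')
    (hv : Exec l (lift σ) v) : k ≠ [] ∧ k' = (Cmd.step (k, σ)).1 ∧ v = lift (Cmd.step (k, σ)).2 := by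
  have hup := hv.eq_update
  have hex := hv.2
  cases h with
  | skip | seq => exact ⟨by simp, rfl, hup.trans (update_eq_self _ _)⟩
  | inc => exact ⟨by simp, rfl, hup.trans (lift_update _ _ _).symm⟩
  | exit i c =>
    have h0 : σ i = 0 := hex.1
    simp only [Cmd.step, if_pos h0]
    exact ⟨by simp, trivial, hup.trans (update_eq_self _ _)⟩
  | enter i c =>
    have h0 : σ i ≠ 0 := by
      have : σ i = v (i + 1) + 1 := hex
      omega
    simp only [Cmd.step, if_neg h0]
    exact ⟨by simp, trivial, hup.trans (lift_update _ _ _).symm⟩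

/-- The instructions for a program, in terms of numbered states. -/
def Cmd.numberedInstrs (c : Cmd) : List (ℕ × (Op × ℕ) × ℕ) :=
  (c.instrs []).map fun t => (2 * Encodable.encode t.1 + 1, t.2.1, 2 * Encodable.encode t.2.2 + 1)

/-- The machine that executes a program with register `0` set to `n`. -/
def Cmd.machine (c : Cmd) (B n : ℕ) : Machine :=
  (2 * n + B, B + 2, (2 * n, (.ifz, 0), 2 * Encodable.encode [c] + 1) ::
    ((List.range n).map (fun j => (2 * j, (.inc, 1), 2 * (j + 1))) ++ c.numberedInstrs))

/-- The instructions of the program do not depend on `n`, so one `B` serves all inputs; this keeps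
the map from `n` to the machine primitive recursive. -/
theorem Cmd.exists_wellFormed (c : Cmd) : ∃ B, ∀ n, (c.machine B n).WellFormed := by
  have key : ∀ L : List (ℕ × (Op × ℕ) × ℕ), ∃ B, ∀ t ∈ L, t.1 ≤ B ∧ t.2.1.2 < B ∧ t.2.2 ≤ B := by
    intro L
    induction L with
    | nil => exact ⟨0, by simp⟩
    | cons t L ih =>
      obtain ⟨B, hB⟩ := ih
      refine ⟨B + t.1 + t.2.1.2 + 1 + t.2.2, ?_⟩
      rw [List.forall_mem_cons]
      refine ⟨by omega, fun t' ht' => ?_⟩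
      have := hB t' ht'
      omega
  obtain ⟨B, hB⟩ := key c.numberedInstrs
  refine ⟨B + 2 * Encodable.encode [c] + 1, fun n t ht => ?_⟩
  simp only [Cmd.machine, List.mem_cons, List.mem_append, List.mem_map, List.mem_range] at ht ⊢
  rcases ht with rfl | ⟨j, hj, rfl⟩ | ht
  · simp only
    omega
  · simp only
    omega
  · have := hB t ht
    omega

/-- The computation of the machine that executes a program. -/
def Cmd.run (c : Cmd) (n m : ℕ) : ℕ × (ℕ → ℕ) :=
  if m ≤ n then (2 * m, lift (update 0 0 m))
  else (2 * Encodable.encode (step^[m - (n + 1)] ([c], update 0 0 n)).1 + 1,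
    lift (step^[m - (n + 1)] ([c], update 0 0 n)).2)

theorem Cmd.run_zero (c : Cmd) (n : ℕ) : c.run n 0 = (0, 0) := by
  rw [run, if_pos (Nat.zero_le n)]
  refine Prod.ext rfl ?_
  funext i
  rcases i with _ | _ | i <;> simp [lift]

theorem Cmd.run_add (c : Cmd) (n m : ℕ) : c.run n (n + 1 + m) =
    (2 * Encodable.encode (step^[m] ([c], update 0 0 n)).1 + 1,
      lift (step^[m] ([c], update 0 0 n)).2) := by
  rw [run, if_neg (by omega), Nat.add_sub_cancel_left]

theorem Cmd.eq_run_of_reach {c : Cmd} {B n m : ℕ} {x : ℕ × (ℕ → ℕ)}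
    (h : (c.machine B n).Reach m x) : x = c.run n m := by
  induction h with
  | zero => exact (c.run_zero n).symm
  | @succ m x y h hs ih =>
    subst ih
    obtain ⟨l, hl, hex⟩ := hs
    obtain ⟨q, v⟩ := y
    simp only [Cmd.machine, Cmd.numberedInstrs, List.mem_cons, List.mem_append, List.mem_map,
      List.mem_range, Prod.mk.injEq] at hl
    -- Even states load the input, odd states encode lists of programs. Parity rules out all
    -- instructions of the wrong phase.
    by_cases hm : m ≤ n
    · rw [run, if_pos hm] at hl hex
      have hup := hex.eq_update
      rcases hl with ⟨h1, rfl, rfl⟩ | ⟨j, hj, h1, rfl, rfl⟩ | ⟨t, ht, h1, rfl, rfl⟩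
      · obtain rfl : m = n := by simp only at h1; omega
        rw [show m + 1 = m + 1 + 0 from rfl, run_add]
        exact Prod.ext rfl (hup.trans (update_eq_self _ _))
      · obtain rfl : j = m := by simp only at h1; omega
        rw [run, if_pos (by omega)]
        refine Prod.ext rfl (hup.trans ?_)
        rw [← lift_update]
        simp [Op.apply, lift]
      · simp only at h1
        omega
    · obtain ⟨m, rfl⟩ : ∃ m', m = n + 1 + m' := ⟨m - (n + 1), by omega⟩
      rw [run_add] at hl hex
      rcases hl with ⟨h1, -⟩ | ⟨j, hj, h1, -⟩ | ⟨t, ht, h1, rfl, rfl⟩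
      · simp only at h1
        omega
      · simp only at h1
        omega
      · have h2 : t.1 = (step^[m] ([c], update 0 0 n)).1 := Encodable.encode_injective (by
          simp only at h1
          omega)
        obtain ⟨-, h3, h4⟩ := (cmdRule_of_mem_instrs ht).eq_step hex
        rw [add_assoc, run_add, iterate_succ_apply', h3]
        rw [h2] at h4 ⊢
        exact Prod.ext rfl h4

/-- After loading and `m` steps the only possible configuration has the empty list as its state, and
no instruction starts there. -/
theorem Cmd.not_reach_of_halts {c : Cmd} {B n m : ℕ} (h : (step^[m] ([c], update 0 0 n)).1 = [])
    (x : ℕ × (ℕ → ℕ)) : ¬ (c.machine B n).Reach (n + 1 + m + 1) x := by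
  intro hx
  cases hx with
  | @succ _ y _ hy hs =>
    obtain rfl := eq_run_of_reach hy
    obtain ⟨l, hl, hex⟩ := hs
    rw [run_add] at hl hex
    simp only [Cmd.machine, Cmd.numberedInstrs, List.mem_cons, List.mem_append, List.mem_map,
      List.mem_range, Prod.mk.injEq] at hl
    rcases hl with ⟨h1, -⟩ | ⟨j, hj, h1, -⟩ | ⟨t, ht, h1, rfl, h5⟩
    · omega
    · omega
    · have h2 : t.1 = (step^[m] ([c], update 0 0 n)).1 := Encodable.encode_injective (by omega)
      exact ((cmdRule_of_mem_instrs ht).eq_step hex).1 (h2.trans h)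

theorem Cmd.step_run_of_not_halts {c : Cmd} {B n : ℕ}
    (h : ∀ m, (step^[m] ([c], update 0 0 n)).1 ≠ []) (m : ℕ) :
    (c.machine B n).Step (c.run n m) (c.run n (m + 1)) := by
  have hmem : ∀ {t}, t ∈ (c.machine B n).2.2 ↔ t = (2 * n, (.ifz, 0), 2 * Encodable.encode [c] + 1) ∨
      (∃ j, j < n ∧ (2 * j, (Op.inc, 1), 2 * (j + 1)) = t) ∨ ∃ t' ∈ c.instrs [],
        (2 * Encodable.encode t'.1 + 1, t'.2.1, 2 * Encodable.encode t'.2.2 + 1) = t := by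
    intro t
    simp only [Cmd.machine, Cmd.numberedInstrs, List.mem_cons, List.mem_append, List.mem_map,
      List.mem_range]
  rcases lt_trichotomy m n with hm | rfl | hm
  · refine ⟨(.inc, 1), hmem.2 (Or.inr (Or.inl ⟨m, hm, ?_⟩)), ?_⟩
    · rw [run, if_pos hm.le, run, if_pos (show m + 1 ≤ n from hm)]
    · rw [run, if_pos hm.le, run, if_pos (show m + 1 ≤ n from hm)]
      have := exec_update (l := (.inc, 1)) (v := lift (update 0 0 m)) (by simp) (by simp)
      rw [← lift_update] at this
      simpa [Op.apply, lift] using this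
  · have e := c.run_add m 0
    rw [add_zero] at e
    refine ⟨(.ifz, 0), hmem.2 (Or.inl ?_), ?_⟩
    · rw [run, if_pos le_rfl, e]
      rfl
    · rw [run, if_pos le_rfl, e]
      exact ⟨fun _ _ => rfl, rfl, rfl⟩
  · obtain ⟨m, rfl⟩ : ∃ m', m = n + 1 + m' := ⟨m - (n + 1), by omega⟩
    have hcov : ∀ m, Covered (c.instrs []) (step^[m] ([c], update 0 0 n)).1 := by
      intro m
      induction m with
      | zero => exact .cons (List.Subset.refl _) .nil
      | succ m ih =>
        rw [iterate_succ_apply']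
        exact ih.step
    obtain ⟨l, hl, hex⟩ := (hcov m).exists_exec (h m)
    rw [← iterate_succ_apply' step] at hl hex
    rw [add_assoc (n + 1), run_add, run_add]
    exact ⟨l, hmem.2 (Or.inr (Or.inr ⟨_, hl, rfl⟩)), hex⟩

theorem Cmd.primrec_machine (c : Cmd) (B : ℕ) : Primrec (c.machine B) := by
  have h2 : ∀ {γ : Type} [Primcodable γ] {f : γ → ℕ}, Primrec f → Primrec fun x => 2 * f x :=
    fun hf => Primrec.nat_mul.comp (Primrec.const 2) hf
  have hpre : Primrec₂ fun (_ j : ℕ) => (2 * j, (Op.inc, 1), 2 * (j + 1)) :=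
    Primrec₂.mk ((h2 Primrec.snd).pair ((Primrec.const _).pair
      (h2 (Primrec.succ.comp Primrec.snd))))
  exact (Primrec.nat_add.comp (h2 Primrec.id) (Primrec.const B)).pair ((Primrec.const _).pair
    (Primrec.list_cons.comp ((h2 Primrec.id).pair (Primrec.const _))
      (Primrec.list_append.comp (Primrec.list_map Primrec.list_range hpre) (Primrec.const _))))

end ICA

/-! ### Undecidability of the nonemptiness problem -/

namespace ICA

open Function Cmd

/-- For a primitive recursive function there is a program that searches for a zero. -/
theorem exists_search_program {g : List.Vector ℕ 2 → ℕ} (hg : Nat.Primrec' g) : ∃ c : Cmd, ∀ n,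
    ((∃ m, (step^[m] ([c], update 0 0 n)).1 = []) ↔ ∃ k, g (n ::ᵥ k ::ᵥ .nil) = 0) := by
  obtain ⟨b, hb⟩ := computes_of_primrec hg (fun i => i.val) 2 3 (fun i => by omega) (by norm_num)
  refine ⟨seq (inc 2) (loop 2 (seq b (inc 1))), fun n => ?_⟩
  -- The flag in register `2`: initially `1`, so that the loop is entered, afterwards the value of
  -- `g` computed last.
  let w : ℕ → ℕ := fun k => Nat.casesOn k 1 fun k => g (n ::ᵥ k ::ᵥ .nil)
  let S : ℕ → ℕ → ℕ := fun k => update (update (update 0 0 n) 1 k) 2 (w k)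
  have hS : ∀ k, S k 2 = w k := fun k => update_self _ _ _
  have h0 : Runs (inc 2) (update 0 0 n) (S 0) := by
    refine (runs_inc _ _).of_eq ?_
    funext j
    simp only [S, show w 0 = 1 from rfl, update_apply, Pi.zero_apply]
    split_ifs <;> first | rfl | omega | contradiction
  have hbody : ∀ k, Runs (seq b (inc 1)) (update (S k) 2 (S k 2 - 1)) (S (k + 1)) := by
    intro k
    refine ((hb _ fun j hj => ?_).seq (runs_inc _ _)).of_eq ?_
    · simp only [S, update_apply, Pi.zero_apply]
      rw [if_neg (by omega), if_neg (by omega), if_neg (by omega), if_neg (by omega)]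
    · have hv : (List.Vector.ofFn fun i : Fin 2 => update (S k) 2 (S k 2 - 1) i.val) =
          n ::ᵥ k ::ᵥ .nil := rfl
      rw [hv]
      have hw : w (k + 1) = g (n ::ᵥ k ::ᵥ .nil) := rfl
      rw [← hw]
      funext j
      simp only [S, update_apply, Pi.zero_apply]
      split_ifs <;> first | rfl | omega
  have hlead : ∀ k, (∀ j < k, g (n ::ᵥ j ::ᵥ .nil) ≠ 0) → ∀ m ≤ k, w m ≠ 0 := by
    intro k hk m hm
    cases m with
    | zero => exact one_ne_zero
    | succ m => exact hk m hm
  constructor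
  · rintro ⟨m, hm⟩
    by_contra! hne
    have hw : ∀ k, w k ≠ 0 := fun k => hlead k (fun j _ => hne j) k le_rfl
    -- If `g` has no zero, the head of the loop is visited at arbitrarily late times. This
    -- contradicts termination, since a finished execution stays finished.
    have hreach : ∀ k, ∃ m, k ≤ m ∧ step^[m] ([seq (inc 2) (loop 2 (seq b (inc 1)))], update 0 0 n) =
        ([loop 2 (seq b (inc 1))], S k) := by
      intro k
      induction k with
      | zero =>
        obtain ⟨m, hm⟩ := Leads.head (x := ([seq (inc 2) (loop 2 (seq b (inc 1)))], update 0 0 n))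
          (h0 _)
        exact ⟨m, Nat.zero_le m, hm⟩
      | succ k ih =>
        obtain ⟨m, hkm, hm⟩ := ih
        have h1 : step ([loop 2 (seq b (inc 1))], S k) =
            ([seq b (inc 1), loop 2 (seq b (inc 1))], update (S k) 2 (S k 2 - 1)) := by
          rw [step, if_neg (by rw [hS]; exact hw k)]
        obtain ⟨m', hm'⟩ := hbody k [loop 2 (seq b (inc 1))]
        refine ⟨m' + (m + 1), by omega, ?_⟩
        rw [iterate_add_apply, iterate_succ_apply', hm, h1, hm']
    have hdone : ∀ m' ≥ m,
        (step^[m'] ([seq (inc 2) (loop 2 (seq b (inc 1)))], update 0 0 n)).1 = [] := by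
      intro m' hm'
      induction m', hm' using Nat.le_induction with
      | base => exact hm
      | succ m' _ ih =>
        rw [iterate_succ_apply']
        revert ih
        generalize step^[m'] ([seq (inc 2) (loop 2 (seq b (inc 1)))], update 0 0 n) = x
        obtain ⟨k, σ⟩ := x
        rintro (rfl : k = [])
        rfl
    obtain ⟨m', hmm', hm'⟩ := hreach m
    have := hdone m' hmm'
    rw [hm'] at this
    simp at this
  · intro hex
    classical
    have hloop : Runs (loop 2 (seq b (inc 1))) (S 0) (S (Nat.find hex + 1)) :=
      Runs.loop S _ (fun m hm => by
          rw [hS]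
          exact hlead _ (fun j hj => Nat.find_min hex hj) m (Nat.lt_succ_iff.1 hm))
        (fun m _ => hbody m) (by rw [hS]; exact Nat.find_spec hex)
    obtain ⟨m, hm⟩ := (h0.seq hloop) []
    exact ⟨m, by rw [hm]⟩

open Nat.Partrec in
/-- The halting problem reduces to emptiness of incrementing counter automata. -/
theorem exists_computable_descr_halting : ∃ F : Code → Descr, Computable F ∧
    ∀ c, (F c).AcceptsSome ↔ ¬ (Code.eval c 0).Dom := by
  -- Zero means that evaluation of the program coded by the first argument halts within the bound
  -- given by the second. The search program is thus universal, and only its input varies with the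
  -- code.
  let g : List.Vector ℕ 2 → ℕ := fun v =>
    bif (Code.evaln v.tail.head (Denumerable.ofNat Code v.head) 0).isSome then 0 else 1
  have hg : Primrec g := by
    have h1 : Primrec fun v : List.Vector ℕ 2 => v.tail.head :=
      Primrec.vector_head.comp Primrec.vector_tail
    have h2 : Primrec fun v : List.Vector ℕ 2 => Denumerable.ofNat Code v.head :=
      (Primrec.ofNat Code).comp Primrec.vector_head
    exact Primrec.cond (Primrec.option_isSome.comp
      (Code.primrec_evaln.comp ((h1.pair h2).pair (Primrec.const 0)))) (Primrec.const 0)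
      (Primrec.const 1)
  obtain ⟨p, hp⟩ := exists_search_program (Nat.Primrec'.of_prim hg)
  obtain ⟨B, hB⟩ := p.exists_wellFormed
  refine ⟨fun c => (p.machine B (Encodable.encode c)).descr,
    (primrec_descr.comp ((p.primrec_machine B).comp Primrec.encode)).to_comp, fun c => ?_⟩
  have hdom : (Code.eval c 0).Dom ↔ ∃ k, g (Encodable.encode c ::ᵥ k ::ᵥ .nil) = 0 := by
    have hgk : ∀ k, g (Encodable.encode c ::ᵥ k ::ᵥ .nil) = 0 ↔ ∃ x, x ∈ Code.evaln k c 0 := by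
      intro k
      simp only [g, List.Vector.tail_cons, List.Vector.head_cons, Denumerable.ofNat_encode]
      cases Code.evaln k c 0 <;> simp
    simp only [hgk, Part.dom_iff_mem, Code.evaln_complete]
    exact exists_comm
  rw [hdom, ← hp, Descr.acceptsSome_iff]
  constructor
  · rintro ⟨τ, hτ⟩ ⟨m, hm⟩
    exact Machine.not_lazyRun_descr (not_reach_of_halts hm) τ hτ
  · intro h
    push Not at h
    exact Machine.exists_lazyRun_descr (hB _) (p.run_zero _) (step_run_of_not_halts h)

end ICA

/-! ### Undecidability of satisfiability -/

open HS in
theorem NonemptinessReducesTo.not_satDecidable {S : Set Modality} (h : NonemptinessReducesTo S) :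
    ¬ SatDecidable S := by
  rintro ⟨d, hd, hdS⟩
  obtain ⟨f, hf, hfS⟩ := h
  obtain ⟨F, hF, hFS⟩ := ICA.exists_computable_descr_halting
  refine ComputablePred.halting_problem 0 (ComputablePred.computable_iff.2
    ⟨fun c => !(d (f (F c))), Primrec.not.to_comp.comp (hd.comp (hf.comp hF)), ?_⟩)
  funext c
  have h1 := hdS _ (hfS (F c)).1
  rw [(hfS (F c)).2, hFS] at h1
  refine propext ?_
  by_cases hc : d (f (F c)) = true
  · simp [hc, h1.1 hc]
  · simp [hc, not_not.1 (mt h1.2 hc)]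

theorem mainTheorem2 :
    (NonemptinessReducesTo {.dir .A, .dir .E} ∧
      NonemptinessReducesTo {.dir .A, .inv .E} ∧
      NonemptinessReducesTo {.inv .A, .dir .B} ∧
      NonemptinessReducesTo {.inv .A, .inv .B}) ∧
    (¬ HS.SatDecidable {.dir .A, .dir .E} ∧
      ¬ HS.SatDecidable {.dir .A, .inv .E} ∧
      ¬ HS.SatDecidable {.inv .A, .dir .B} ∧
      ¬ HS.SatDecidable {.inv .A, .inv .B}) := by
  have h1 : HS.ForbParam (.dir .E) true := Or.inl ⟨rfl, rfl⟩
  have h2 : HS.ForbParam (.inv .E) false := Or.inr ⟨rfl, rfl⟩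
  have r1 := nonemptinessReducesTo_of_forbParam h1
  have r2 := nonemptinessReducesTo_of_forbParam h2
  have r3 : NonemptinessReducesTo {.inv .A, .dir .B} := nonemptinessReducesTo_mirror_of_forbParam h1
  have r4 : NonemptinessReducesTo {.inv .A, .inv .B} := nonemptinessReducesTo_mirror_of_forbParam h2
  exact ⟨⟨r1, r2, r3, r4⟩, r1.not_satDecidable, r2.not_satDecidable, r3.not_satDecidable,
    r4.not_satDecidable⟩
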